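/- Let $\ell\ge 0$, $r\in\mathbb R\setminus\{0\}$, $\sigma=(\sigma_1,\dots,\sigma_{\ell+1})\in\mathbb R^{\ell+1}=\mathrm{Lie}(U_1^{\ell+1})$, and let $\epsilon\in\mathbb R$ satisfy $\epsilon>\max_j(-\sigma_j)$. Equip $\mathbb C^{\ell+1}$ with the symplectic form $\Omega=\frac{\imath}{2}\sum_j d\varphi^j\wedge d\bar\varphi^j$, on which $U_1^{\ell+1}$ acts diagonally with momenta $\mu_j=-\frac12|\varphi^j|^2$ and the diagonal $U_1$ acts with momentum $\mu=\sum_j\mu_j$. Let $\mathbb P^\ell=\{\mu+\frac{r^2}{2}=0\}/U_1$ be the Hamiltonian reduction, with reduced symplectic form $\omega_{\mathbb P^\ell}$ and induced momenta $\mu_j^{\mathbb P^\ell}$. Let $\theta=r^{-2}\sum_j\mathrm{Im}(\bar\varphi^j d\varphi^j)$ be the canonical connection form of the $U_1$-bundle $\{\mu+\frac{r^2}{2}=0\}\to\mathbb P^\ell$, let $v_\sigma=(\imath\sigma_j\varphi^j)_j$ be the vector field generated by $\sigma$, and let $c_1^{eq}=d\theta-\theta(v_\sigma)$ be the equivariant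 first Chern form of $\mathcal O(1)$ on $\mathbb P^\ell$ (the equivariant curvature for the Cartan differential $d-\iota_{v_\sigma}$, normalized without the factor $\frac1{2\pi}$). Then $$\tfrac{r^2}{2}\,c_1^{eq}=\omega_{\mathbb P^\ell}+\sum_{j=1}^{\ell+1}\sigma_j\,\mu_j^{\mathbb P^\ell},$$ and the $U_1^{\ell+1}$-equivariant symplectic volume of $\mathbb P^\ell$ is $$\int_{\mathbb P^\ell}\exp\Big(\tfrac{r^2}{2}c_1^{eq}\Big)=(2\pi)^{\ell-1}\int_{\mathbb R-\imath\epsilon}dH\,\frac{e^{\imath r^2H/2}}{\prod_{j=1}^{\ell+1}(\imath H+\sigma_j)}.$$ Here $\int_{\mathbb P^\ell}\exp(\alpha)$ is the integral of the component of degree $2\ell$ of $\exp(\alpha)$, and the contour integral is absolutely convergent for $\ell\ge1$ and a convergent improper integral in any case. -/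

import Mathlib

open Complex Filter Topology MeasureTheory
open scoped ComplexConjugate

noncomputable section

namespace ProjectiveReduction

/-! ### The Hamiltonian space `ℂ^(ℓ+1)` -/

/-- The momentum `μ_j(φ) = -|φ_j|²/2` of the `j`-th factor of `U_1^(ℓ+1)` acting diagonally. -/
def momentum {ℓ : ℕ} (j : Fin (ℓ + 1)) (φ : Fin (ℓ + 1) → ℂ) : ℝ :=
  -(1 / 2) * ‖φ j‖ ^ 2

/-- The momentum `μ(φ) = -(1/2) ∑_j |φ_j|²` of the diagonal `U_1`. -/
def totalMomentum {ℓ : ℕ} (φ : Fin (ℓ + 1) → ℂ) : ℝ :=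
  -(1 / 2) * ∑ j, ‖φ j‖ ^ 2

/-- The real bilinear form `∑_j Im (conj (u_j) v_j)`. -/
def imPairing (ℓ : ℕ) : (Fin (ℓ + 1) → ℂ) →L[ℝ] (Fin (ℓ + 1) → ℂ) →L[ℝ] ℝ :=
  LinearMap.toContinuousBilinearMap
    (LinearMap.mk₂ ℝ (fun u v : Fin (ℓ + 1) → ℂ => ∑ j, (conj (u j) * v j).im)
      (by intro u u' v; simp only [← Finset.sum_add_distrib, Pi.add_apply, map_add, add_mul, add_im])
      (by
        intro c u v
        simp only [Finset.smul_sum, Pi.smul_apply]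
        refine Finset.sum_congr rfl fun j _ => ?_
        simp
        ring)
      (by intro u v v'; simp only [← Finset.sum_add_distrib, Pi.add_apply, mul_add, add_im])
      (by
        intro c u v
        simp only [Finset.smul_sum, Pi.smul_apply]
        refine Finset.sum_congr rfl fun j _ => ?_
        simp
        ring))

theorem imPairing_apply {ℓ : ℕ} (u v : Fin (ℓ + 1) → ℂ) :
    imPairing ℓ u v = ∑ j, (conj (u j) * v j).im := rfl

theorem imPairing_self {ℓ : ℕ} (u : Fin (ℓ + 1) → ℂ) : imPairing ℓ u u = 0 := by
  rw [imPairing_apply]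
  refine Finset.sum_eq_zero fun j _ => ?_
  simp
  ring

theorem imPairing_swap {ℓ : ℕ} (u v : Fin (ℓ + 1) → ℂ) :
    imPairing ℓ u v = -imPairing ℓ v u := by
  rw [imPairing_apply, imPairing_apply, ← Finset.sum_neg_distrib]
  refine Finset.sum_congr rfl fun j _ => ?_
  simp
  ring

/-- The symplectic form `Ω = (i/2) ∑_j dφ_j ∧ d(conj φ_j) = ∑_j dx_j ∧ dy_j` on `ℂ^(ℓ+1)`, where
`φ_j = x_j + i y_j`; explicitly `Ω(u, v) = ∑_j Im (conj (u_j) v_j)`. -/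
def symplecticForm (ℓ : ℕ) : (Fin (ℓ + 1) → ℂ) [⋀^Fin 2]→L[ℝ] ℝ where
  toFun v := imPairing ℓ (v 0) (v 1)
  map_update_add' m i x y := by fin_cases i <;> simp [Function.update]
  map_update_smul' m i c x := by fin_cases i <;> simp [Function.update]
  cont := by fun_prop
  map_eq_zero_of_eq' v i j h hij := by
    fin_cases i <;> fin_cases j <;> simp_all [imPairing_self]

theorem symplecticForm_apply {ℓ : ℕ} (v : Fin 2 → Fin (ℓ + 1) → ℂ) :
    symplecticForm ℓ v = imPairing ℓ (v 0) (v 1) := rfl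

theorem norm_circle_smul {ℓ : ℕ} (c : Circle) (φ : Fin (ℓ + 1) → ℂ) (j : Fin (ℓ + 1)) :
    ‖(c • φ) j‖ = ‖φ j‖ := by
  change ‖c • φ j‖ = ‖φ j‖
  rw [Circle.smul_def, smul_eq_mul, norm_mul, Circle.norm_coe, one_mul]

theorem imPairing_circle_smul {ℓ : ℕ} (c : Circle) (u v : Fin (ℓ + 1) → ℂ) :
    imPairing ℓ (c • u) (c • v) = imPairing ℓ u v := by
  rw [imPairing_apply, imPairing_apply]
  refine Finset.sum_congr rfl fun j _ => ?_
  have hc : conj (c : ℂ) * (c : ℂ) = 1 := by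
    rw [mul_comm, Complex.mul_conj, Circle.normSq_coe, ofReal_one]
  congr 1
  calc conj ((c • u) j) * (c • v) j
      = (conj (c : ℂ) * (c : ℂ)) * (conj (u j) * v j) := by
        simp only [Pi.smul_apply, Circle.smul_def, smul_eq_mul, map_mul]
        ring
    _ = conj (u j) * v j := by rw [hc, one_mul]

/-! ### The reduced space `ℙ^ℓ = {μ + r²/2 = 0} / U_1` -/

/-- The level set `{μ + r²/2 = 0}`, i.e. the sphere `∑_j |φ_j|² = r²`, with its `U_1`-action. -/
def levelSet (ℓ : ℕ) (r : ℝ) : SubMulAction Circle (Fin (ℓ + 1) → ℂ) where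
  carrier := {φ | totalMomentum φ + r ^ 2 / 2 = 0}
  smul_mem' c φ h := by
    simpa only [Set.mem_ofPred_eq, totalMomentum, norm_circle_smul] using h

/-- The projective space `ℙ^ℓ` as the Hamiltonian reduction of `ℂ^(ℓ+1)` by `U_1`. -/
def ReducedSpace (ℓ : ℕ) (r : ℝ) : Type :=
  MulAction.orbitRel.Quotient Circle (levelSet ℓ r)

/-- The point of the reduced space represented by a point of the level set. -/
def toReduced {ℓ : ℕ} {r : ℝ} (φ : levelSet ℓ r) : ReducedSpace ℓ r :=
  Quotient.mk (MulAction.orbitRel Circle (levelSet ℓ r)) φ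

/-- The function on the reduced space induced by a `U_1`-invariant function. -/
def descend {ℓ : ℕ} {r : ℝ} (f : (Fin (ℓ + 1) → ℂ) → ℝ)
    (hf : ∀ (c : Circle) (φ : Fin (ℓ + 1) → ℂ), f (c • φ) = f φ) : ReducedSpace ℓ r → ℝ :=
  Quotient.lift (fun φ : levelSet ℓ r => f φ) (by
    rintro φ ψ ⟨c, rfl⟩
    exact hf c ψ)

/-- The vectors tangent to the level set at `φ`: the kernel of `dμ_φ(u) = -∑_j Re (conj (φ_j) u_j)`. -/
def IsTangent {ℓ : ℕ} (φ u : Fin (ℓ + 1) → ℂ) : Prop :=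
  ∑ j, (conj (φ j) * u j).re = 0

/-- An inhomogeneous differential form of degree `0` and `2` on the reduced space (the value, at an
element of the Lie algebra of `U_1^(ℓ+1)`, of an element of degree two of the Cartan complex).
As usual for the quotient by a free action, a two-form on the quotient is given by a basic two-form
on the level set, i.e. one which is `U_1`-invariant and vanishes on the generator `i φ` of the
`U_1`-action. -/
@[ext]
structure CartanForm (ℓ : ℕ) (r : ℝ) where
  /-- the component of degree zero -/
  deg0 : ReducedSpace ℓ r → ℝ
  /-- the component of degree two -/
  deg2 : (Fin (ℓ + 1) → ℂ) → (Fin (ℓ + 1) → ℂ) [⋀^Fin 2]→L[ℝ] ℝ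
  invariant : ∀ (c : Circle), ∀ φ ∈ levelSet ℓ r, ∀ u v, IsTangent φ u → IsTangent φ v →
    deg2 (c • φ) ![c • u, c • v] = deg2 φ ![u, v]
  horizontal : ∀ φ ∈ levelSet ℓ r, ∀ u, IsTangent φ u → deg2 φ ![I • φ, u] = 0

/-- Multiplication of a form by a real number. -/
def CartanForm.scale {ℓ : ℕ} {r : ℝ} (a : ℝ) (α : CartanForm ℓ r) : CartanForm ℓ r where
  deg0 p := a * α.deg0 p
  deg2 φ := a • α.deg2 φ
  invariant c φ hφ u v hu hv := by
    simp only [ContinuousAlternatingMap.smul_apply, α.invariant c φ hφ u v hu hv]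
  horizontal φ hφ u hu := by
    simp only [ContinuousAlternatingMap.smul_apply, α.horizontal φ hφ u hu, smul_zero]

theorem imPairing_horizontal {ℓ : ℕ} {φ u : Fin (ℓ + 1) → ℂ} (hu : IsTangent φ u) :
    imPairing ℓ (I • φ) u = 0 := by
  rw [imPairing_apply, ← neg_eq_zero, ← Finset.sum_neg_distrib, ← hu]
  refine Finset.sum_congr rfl fun j _ => ?_
  simp
  ring

/-- The equivariant symplectic form `ω + ∑_j σ_j μ_j` on the reduced space: `ω` is the reduced
symplectic form, whose pull back to the level set is the restriction of `Ω`, and the momenta are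
those induced by the `μ_j`. -/
def equivariantSymplecticForm (ℓ : ℕ) (r : ℝ) (σ : Fin (ℓ + 1) → ℝ) : CartanForm ℓ r where
  deg0 := descend (fun φ => ∑ j, σ j * momentum j φ) (by
    intro c φ
    simp only [momentum, norm_circle_smul])
  deg2 _ := symplecticForm ℓ
  invariant c φ _ u v _ _ := imPairing_circle_smul c u v
  horizontal _ _ _ hu := imPairing_horizontal hu

/-! ### The equivariant first Chern class of `𝒪(1)` -/

/-- The canonical connection one-form `θ = r⁻² ∑_j Im (conj (φ_j) dφ_j)` of the principal
`U_1`-bundle `{∑_j |φ_j|² = r²} → ℙ^ℓ`; it takes the value `1` on the generator `i φ`. -/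
def connectionForm (ℓ : ℕ) (r : ℝ) (φ : Fin (ℓ + 1) → ℂ) :
    (Fin (ℓ + 1) → ℂ) [⋀^Fin 1]→L[ℝ] ℝ :=
  ContinuousAlternatingMap.ofSubsingleton ℝ (Fin (ℓ + 1) → ℂ) ℝ (0 : Fin 1)
    ((r ^ 2)⁻¹ • imPairing ℓ φ)

theorem connectionForm_apply {ℓ : ℕ} (r : ℝ) (φ : Fin (ℓ + 1) → ℂ) (v : Fin 1 → Fin (ℓ + 1) → ℂ) :
    connectionForm ℓ r φ v = (r ^ 2)⁻¹ * imPairing ℓ φ (v 0) := rfl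

theorem extDeriv_connectionForm (ℓ : ℕ) (r : ℝ) (φ : Fin (ℓ + 1) → ℂ) :
    extDeriv (connectionForm ℓ r) φ = (2 / r ^ 2) • symplecticForm ℓ := by
  let L : (Fin (ℓ + 1) → ℂ) →L[ℝ] (Fin (ℓ + 1) → ℂ) [⋀^Fin 1]→L[ℝ] ℝ :=
    ((ContinuousAlternatingMap.ofSubsingletonLIE (𝕜 := ℝ) (E := Fin (ℓ + 1) → ℂ) (F := ℝ) (0 : Fin 1)
      ).toContinuousLinearEquiv : _ →L[ℝ] _).comp ((r ^ 2)⁻¹ • imPairing ℓ)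
  have hL : connectionForm ℓ r = L := rfl
  ext v
  have hd (u : Fin (ℓ + 1) → ℂ) (m : Fin 1 → Fin (ℓ + 1) → ℂ) :
      fderiv ℝ (fun x => L x m) φ u = (r ^ 2)⁻¹ * imPairing ℓ u (m 0) := by
    let M : (Fin (ℓ + 1) → ℂ) →L[ℝ] ℝ := (r ^ 2)⁻¹ • (imPairing ℓ).flip (m 0)
    have hM : (fun x => L x m) = M := rfl
    rw [hM, M.fderiv]
    rfl
  rw [hL, extDeriv_apply L.differentiableAt]
  simp only [hd]
  rw [Fin.sum_univ_two, ContinuousAlternatingMap.smul_apply, symplecticForm_apply]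
  have h0 : (0 : Fin 2).removeNth v 0 = v 1 := rfl
  have h1 : (1 : Fin 2).removeNth v 0 = v 0 := rfl
  simp only [h0, h1, imPairing_swap (v 1) (v 0), smul_eq_mul, Fin.val_zero, Fin.val_one]
  ring

/-- The vector field `(i σ_j φ_j)_j` generated by the element `σ` of the Lie algebra of
`U_1^(ℓ+1)`. -/
def torusVector {ℓ : ℕ} (σ : Fin (ℓ + 1) → ℝ) (φ : Fin (ℓ + 1) → ℂ) : Fin (ℓ + 1) → ℂ :=
  fun j => I * (σ j : ℂ) * φ j

theorem torusVector_circle_smul {ℓ : ℕ} (σ : Fin (ℓ + 1) → ℝ) (c : Circle)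
    (φ : Fin (ℓ + 1) → ℂ) : torusVector σ (c • φ) = c • torusVector σ φ := by
  funext j
  simp only [torusVector, Pi.smul_apply, Circle.smul_def, smul_eq_mul]
  ring

/-- The equivariant first Chern form of `𝒪(1)`: the equivariant curvature `d θ - θ(v_σ)` of the
canonical connection (without the factor `1/(2π)`), for the Cartan differential `d - ι_{v_σ}`. -/
def equivariantChernForm (ℓ : ℕ) (r : ℝ) (σ : Fin (ℓ + 1) → ℝ) : CartanForm ℓ r where
  deg0 := descend (fun φ => -connectionForm ℓ r φ ![torusVector σ φ]) (by
    intro c φ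
    simp only [torusVector_circle_smul, connectionForm_apply, Matrix.cons_val_zero,
      imPairing_circle_smul])
  deg2 φ := extDeriv (connectionForm ℓ r) φ
  invariant c φ _ u v _ _ := by
    simp [extDeriv_connectionForm, symplecticForm_apply, imPairing_circle_smul]
  horizontal φ _ u hu := by
    simp [extDeriv_connectionForm, symplecticForm_apply, imPairing_horizontal hu]

/-! ### Integration over the reduced space -/

/-- The point of the level set over the point with inhomogeneous coordinates `w` in the `k`-th
standard chart: `r (1 + |w|²)^(-1/2) (w_1, …, 1, …, w_ℓ)` with `1` in the place `k`. -/
def sphereLift {ℓ : ℕ} (r : ℝ) (k : Fin (ℓ + 1)) (w : Fin ℓ → ℂ) : Fin (ℓ + 1) → ℂ :=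
  ((r / √(1 + ∑ i, ‖w i‖ ^ 2) : ℝ) : ℂ) • k.insertNth (α := fun _ => ℂ) 1 w

theorem sphereLift_mem {ℓ : ℕ} (r : ℝ) (k : Fin (ℓ + 1)) (w : Fin ℓ → ℂ) :
    sphereLift r k w ∈ levelSet ℓ r := by
  have h : (0 : ℝ) < 1 + ∑ i, ‖w i‖ ^ 2 := by positivity
  change totalMomentum (sphereLift r k w) + r ^ 2 / 2 = 0
  simp only [totalMomentum, sphereLift, Pi.smul_apply, smul_eq_mul, norm_mul, mul_pow,
    Complex.norm_real, Real.norm_eq_abs, sq_abs, div_pow, Real.sq_sqrt h.le, ← Finset.mul_sum]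
  rw [Fin.sum_univ_succAbove _ k]
  simp only [Fin.insertNth_apply_same, Fin.insertNth_apply_succAbove, norm_one, one_pow]
  field_simp
  ring

/-- The inverse of the `k`-th standard chart of the reduced space; its image is `{φ_k ≠ 0}`. -/
def param {ℓ : ℕ} (r : ℝ) (k : Fin (ℓ + 1)) (w : Fin ℓ → ℂ) : ReducedSpace ℓ r :=
  toReduced ⟨sphereLift r k w, sphereLift_mem r k w⟩

/-- The functions `|φ_k|²/r²`. They sum to `1` on the reduced space (for `r ≠ 0`), and the `k`-th
one vanishes outside of the `k`-th standard chart. -/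
def weight {ℓ : ℕ} {r : ℝ} (k : Fin (ℓ + 1)) : ReducedSpace ℓ r → ℝ :=
  descend (fun φ => ‖φ k‖ ^ 2 / r ^ 2) (by
    intro c φ
    simp only [norm_circle_smul])

/-- The coordinate expression of the component of degree two in the `k`-th standard chart. -/
def CartanForm.coordDeg2 {ℓ : ℕ} {r : ℝ} (α : CartanForm ℓ r) (k : Fin (ℓ + 1)) (w : Fin ℓ → ℂ) :
    (Fin ℓ → ℂ) [⋀^Fin 2]→L[ℝ] ℝ :=
  (α.deg2 (sphereLift r k w)).compContinuousLinearMap (fderiv ℝ (sphereLift r k) w)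

/-- The wedge power `ω^n = ω ∧ ⋯ ∧ ω` of a two-form, evaluated on the `2n` vectors
`v (0, 0), v (0, 1), v (1, 0), v (1, 1), …` (in this order). -/
def wedgePower {V : Type*} [AddCommGroup V] [Module ℝ V] [TopologicalSpace V] (n : ℕ)
    (ω : V [⋀^Fin 2]→L[ℝ] ℝ) (v : Fin n × Fin 2 → V) : ℝ :=
  (1 / 2 ^ n) * ∑ τ : Equiv.Perm (Fin n × Fin 2),
    ((Equiv.Perm.sign τ : ℤ) : ℝ) * ∏ i : Fin n, ω ![v (τ (i, 0)), v (τ (i, 1))]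

/-- The standard oriented real frame `∂/∂x_1, ∂/∂y_1, ∂/∂x_2, …` of `ℂ^ℓ`. -/
def standardFrame (ℓ : ℕ) (p : Fin ℓ × Fin 2) : Fin ℓ → ℂ :=
  Pi.single p.1 (![1, I] p.2)

/-- The component `exp(α₀) α₂^ℓ / ℓ!` of top degree `2ℓ` of `exp(α₀ + α₂)`, in the `k`-th standard
chart, as a multiple of the Lebesgue form `dx_1 ∧ dy_1 ∧ ⋯ ∧ dx_ℓ ∧ dy_ℓ`. -/
def CartanForm.expTop {ℓ : ℕ} {r : ℝ} (α : CartanForm ℓ r) (k : Fin (ℓ + 1)) (w : Fin ℓ → ℂ) : ℝ :=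
  Real.exp (α.deg0 (param r k w)) *
    (wedgePower ℓ (α.coordDeg2 k w) (standardFrame ℓ) / (Nat.factorial ℓ : ℝ))

/-- The integral `∫_{ℙ^ℓ} exp(α)`, computed in the standard charts with the help of the partition of
unity `weight`. -/
def CartanForm.integralExp {ℓ : ℕ} {r : ℝ} (α : CartanForm ℓ r) : ℝ :=
  ∑ k : Fin (ℓ + 1), ∫ w : Fin ℓ → ℂ, weight k (param r k w) * α.expTop k w

/-- The integrand `exp(i r² H / 2) / ∏_j (i H + σ_j)` of the contour integral. -/
def contourIntegrand {ℓ : ℕ} (r : ℝ) (σ : Fin (ℓ + 1) → ℝ) (H : ℂ) : ℂ :=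
  Complex.exp (I * (r : ℂ) ^ 2 * H / 2) / ∏ j, (I * H + (σ j : ℂ))

end ProjectiveReduction

end

/-!
The volume identity rests on the Duistermaat–Heckman picture: `ℂ^(ℓ+1)` is fibred by the level sets
of the diagonal momentum, so a Gaussian integral over `ℂ^(ℓ+1)` is the Laplace transform, in the
level `t = r² / 2`, of the equivariant volume of the reduced space.

* The identity of forms follows from `dθ = (2 / r²) Ω` and `θ(v_σ) = r⁻² ∑_j σ_j |φ_j|²`
  (`scale_equivariantChernForm`).
* In a standard chart, with `N = 1 + |w|²`, the reduced symplectic form is the pull back of the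
  standard one by a complex linear map of complex determinant `(r / √N)^ℓ / √N`
  (`compContinuousLinearMap_fderiv_sphereLift`, `det_chartRoot`). A wedge power of top degree scales
  by the real determinant, which is the squared modulus of the complex one, so the volume density
  is `r^(2ℓ) / N^(ℓ+1)` (`wedgePower_reducedForm`).
* The volume `levelVolume σ t` thereby becomes a sum of chart integrals of `chartDensity`. In the
  Gaussian integral `∫ exp (-∑_j (s + σ_j) |φ_j|² / 2) = ∏_j 2π / (s + σ_j)` one inserts the partition
  of unity `|φ_k|² / |φ|²` and substitutes `φ_k = z`, `φ_i = |z| w_i`, `t = N |z|² / 2`; the result is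
  `2π` times the Laplace transform of `levelVolume σ` (`laplace_levelVolume`).
* On the line `s = ε + i x` the Laplace transform is the Fourier transform of an integrable function
  that is continuous at `t`. For `ℓ ≥ 1` it is integrable in `x`, and Fourier inversion gives the
  contour integral (`laplace_inversion`, `levelVolume_eq_contour_integral`). For `ℓ = 0` the contour
  integral converges only conditionally, and an integration by parts reduces it to the inversion for
  the double pole `(s + σ)⁻²` (`tendsto_integral_exp_div`).
-/

namespace ProjectiveReduction


/-! ### Wedge powers of two-forms -/

section WedgePower

variable {V : Type*} [AddCommGroup V] [Module ℝ V] [TopologicalSpace V]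

theorem prod_pairs_update {n : ℕ} (ω : V [⋀^Fin 2]→L[ℝ] ℝ) [DecidableEq (Fin n × Fin 2)]
    (v : Fin n × Fin 2 → V) (i : Fin n) (b : Fin 2) (x : V) :
    ∏ j, ω ![Function.update v (i, b) x (j, 0), Function.update v (i, b) x (j, 1)] =
      ω (Function.update ![v (i, 0), v (i, 1)] b x) *
        ∏ j ∈ Finset.univ \ {i}, ω ![v (j, 0), v (j, 1)] := by
  rw [← Finset.prod_update_of_mem (Finset.mem_univ i)]
  refine Finset.prod_congr rfl fun j _ => ?_
  by_cases hj : j = i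
  · subst hj
    rw [Function.update_self]
    congr 1
    ext c
    fin_cases b <;> fin_cases c <;> simp [Function.update]
  · rw [Function.update_of_ne hj, Function.update_of_ne (by simp [hj]),
      Function.update_of_ne (by simp [hj])]

/-- The multilinear map `v ↦ ∏_i ω(v (i, 0), v (i, 1))`, whose alternatization is a multiple of the
wedge power `ω^n`. -/
noncomputable def prodPairs (n : ℕ) (ω : V [⋀^Fin 2]→L[ℝ] ℝ) :
    MultilinearMap ℝ (fun _ : Fin n × Fin 2 => V) ℝ where
  toFun v := ∏ i, ω ![v (i, 0), v (i, 1)]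
  map_update_add' := by
    rintro _ v ⟨i, b⟩ x y
    simp only [prod_pairs_update, ContinuousAlternatingMap.map_update_add, add_mul]
  map_update_smul' := by
    rintro _ v ⟨i, b⟩ c x
    simp only [prod_pairs_update, ContinuousAlternatingMap.map_update_smul, smul_eq_mul, mul_assoc]

theorem wedgePower_eq_alternatization (n : ℕ) (ω : V [⋀^Fin 2]→L[ℝ] ℝ) (v : Fin n × Fin 2 → V) :
    wedgePower n ω v = (1 / 2 ^ n) * MultilinearMap.alternatization (prodPairs n ω) v := by
  rw [wedgePower, MultilinearMap.alternatization_apply]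
  congr 1
  refine Finset.sum_congr rfl fun τ _ => ?_
  rw [MultilinearMap.domDomCongr_apply, Units.smul_def, zsmul_eq_mul]
  rfl

/-- A wedge power of top degree is multiplied by the determinant under a linear map. -/
theorem wedgePower_comp_basis {n : ℕ} (ω : V [⋀^Fin 2]→L[ℝ] ℝ)
    (e : Module.Basis (Fin n × Fin 2) ℝ V) (A : V →ₗ[ℝ] V) :
    wedgePower n ω (fun p => A (e p)) = LinearMap.det A * wedgePower n ω e := by
  rw [wedgePower_eq_alternatization, wedgePower_eq_alternatization,
    AlternatingMap.eq_smul_basis_det e (MultilinearMap.alternatization (prodPairs n ω))]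
  simp only [AlternatingMap.smul_apply, smul_eq_mul, Module.Basis.det_self, mul_one]
  have h : e.det (fun p => A (e p)) = LinearMap.det A := by
    have := e.det_comp A e
    rwa [Module.Basis.det_self, mul_one] at this
  rw [h]
  ring

/-- If `e` is a symplectic frame for `ω`, then `ω^n(e) = n!`: the permutations that contribute are
those which permute the `n` pairs and the vectors within each pair, and each of the `2^n n!` of
them contributes `1`. -/
theorem wedgePower_symplecticFrame {n : ℕ} (ω : V [⋀^Fin 2]→L[ℝ] ℝ) (e : Fin n × Fin 2 → V)
    (h0 : ∀ p q : Fin n × Fin 2, p.1 ≠ q.1 → ω ![e p, e q] = 0)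
    (h1 : ∀ i, ω ![e (i, 0), e (i, 1)] = 1) :
    wedgePower n ω e = (Nat.factorial n : ℝ) := by
  classical
  let T : Equiv.Perm (Fin n) × (Fin n → Equiv.Perm (Fin 2)) → Equiv.Perm (Fin n × Fin 2) :=
    fun x => Equiv.prodCongrLeft (fun _ => x.1) * Equiv.prodCongrRight x.2
  have hT (x) (i : Fin n) (b : Fin 2) : T x (i, b) = (x.1 i, x.2 i b) := rfl
  -- Moving the pairs is an even permutation, as it acts in the same way on both members.
  have hsign (x) : (Equiv.Perm.sign (T x) : ℤ) = ∏ i, (Equiv.Perm.sign (x.2 i) : ℤ) := by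
    simp only [T]
    rw [Equiv.Perm.sign_mul, Equiv.Perm.sign_prodCongrLeft, Equiv.Perm.sign_prodCongrRight]
    simp
  have h10 (i) : ω ![e (i, 1), e (i, 0)] = -1 := by
    rw [← h1 i]
    have := ω.toAlternatingMap.map_swap ![e (i, 0), e (i, 1)] (i := 0) (j := 1) (by decide)
    have hswap : ![e (i, 0), e (i, 1)] ∘ Equiv.swap 0 1 = ![e (i, 1), e (i, 0)] := by
      ext c
      fin_cases c <;> rfl
    rwa [hswap] at this
  have hperm (p : Equiv.Perm (Fin 2)) (i : Fin n) :
      ω ![e (i, p 0), e (i, p 1)] = ((Equiv.Perm.sign p : ℤ) : ℝ) := by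
    have : p = 1 ∨ p = Equiv.swap 0 1 := by
      revert p; decide
    rcases this with rfl | rfl
    · simp [h1]
    · simp [h10]
  have hinj : Function.Injective T := by
    rintro ⟨π, ε⟩ ⟨π', ε'⟩ h
    have h' (i b) : (π i, ε i b) = (π' i, ε' i b) :=
      congrArg (fun τ : Equiv.Perm _ => τ (i, b)) h
    simp only [Prod.mk.injEq] at h' ⊢
    exact ⟨Equiv.ext fun i => (h' i 0).1, funext fun i => Equiv.ext fun b => (h' i b).2⟩
  have hsum : ∑ τ : Equiv.Perm (Fin n × Fin 2), ((Equiv.Perm.sign τ : ℤ) : ℝ) *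
      ∏ i : Fin n, ω ![e (τ (i, 0)), e (τ (i, 1))] =
      ∑ _x : Equiv.Perm (Fin n) × (Fin n → Equiv.Perm (Fin 2)), (1 : ℝ) := by
    symm
    refine Finset.sum_of_injOn T hinj.injOn (by simp) ?_ ?_
    · -- A permutation with nonzero contribution maps pairs to pairs, hence is in the image of `T`.
      intro τ _ hτ
      by_contra hne
      apply hτ
      have hpair (i) : (τ (i, 0)).1 = (τ (i, 1)).1 := by
        by_contra hi
        exact hne (mul_eq_zero_of_right _
          (Finset.prod_eq_zero (Finset.mem_univ i) (h0 _ _ hi)))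
      have hfst (i b) : (τ (i, b)).1 = (τ (i, 0)).1 := by
        fin_cases b
        · rfl
        · exact (hpair i).symm
      have hπ : Function.Injective fun i => (τ (i, 0)).1 := by
        rw [Finite.injective_iff_surjective]
        intro j
        refine ⟨(τ.symm (j, 0)).1, ?_⟩
        change (τ ((τ.symm (j, 0)).1, 0)).1 = j
        rw [← hfst _ (τ.symm (j, 0)).2, Prod.mk.eta, Equiv.apply_symm_apply]
      have hε (i) : Function.Injective fun b => (τ (i, b)).2 := by
        intro b b' h
        have : τ (i, b) = τ (i, b') := Prod.ext ((hfst i b).trans (hfst i b').symm) h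
        simpa using τ.injective this
      refine ⟨(Equiv.ofBijective _ (Finite.injective_iff_bijective.mp hπ),
        fun i => Equiv.ofBijective _ (Finite.injective_iff_bijective.mp (hε i))), by simp, ?_⟩
      ext1 ⟨i, b⟩
      rw [hT]
      exact Prod.ext (hfst i b).symm rfl
    · intro x _
      simp only [hT, hperm, hsign, Int.cast_prod]
      rw [← Finset.prod_mul_distrib]
      symm
      refine Finset.prod_eq_one fun i _ => ?_
      rw [← Int.cast_mul, Int.units_coe_mul_self, Int.cast_one]
  rw [wedgePower, hsum]
  simp only [Finset.sum_const, Finset.card_univ, Fintype.card_prod, Fintype.card_perm,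
    Fintype.card_pi, Fintype.card_fin, Finset.prod_const, nsmul_eq_mul, mul_one]
  push_cast
  simp only [Nat.factorial_two, Nat.cast_ofNat]
  field_simp

end WedgePower


/-! ### The reduced symplectic form in the standard charts -/

/-- The inclusion of `ℂ^ℓ` into `ℂ^(ℓ+1)` as the hyperplane where the `k`-th coordinate vanishes. -/
noncomputable def hyperplaneIncl {ℓ : ℕ} (k : Fin (ℓ + 1)) :
    (Fin ℓ → ℂ) →L[ℝ] (Fin (ℓ + 1) → ℂ) :=
  LinearMap.toContinuousLinearMap
    { toFun := fun u => k.insertNth (α := fun _ => ℂ) 0 u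
      map_add' := fun u v => by
        ext j
        refine Fin.succAboveCases k ?_ (fun i => ?_) j <;> simp
      map_smul' := fun c u => by
        ext j
        refine Fin.succAboveCases k ?_ (fun i => ?_) j <;> simp }

theorem hyperplaneIncl_apply {ℓ : ℕ} (k : Fin (ℓ + 1)) (u : Fin ℓ → ℂ) :
    hyperplaneIncl k u = k.insertNth (α := fun _ => ℂ) 0 u := rfl

/-- The hermitian pairing `∑_i conj (u_i) v_i`. -/
noncomputable def hermitianPairing {n : ℕ} (u v : Fin n → ℂ) : ℂ := ∑ i, conj (u i) * v i

theorem hermitianPairing_self {n : ℕ} (u : Fin n → ℂ) :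
    hermitianPairing u u = ((∑ i, ‖u i‖ ^ 2 : ℝ) : ℂ) := by
  simp [hermitianPairing, Complex.conj_mul']

theorem conj_hermitianPairing {n : ℕ} (u v : Fin n → ℂ) :
    conj (hermitianPairing u v) = hermitianPairing v u := by
  simp [hermitianPairing, mul_comm]

theorem hermitianPairing_add_right {n : ℕ} (u v v' : Fin n → ℂ) :
    hermitianPairing u (v + v') = hermitianPairing u v + hermitianPairing u v' := by
  simp [hermitianPairing, mul_add, Finset.sum_add_distrib]

theorem hermitianPairing_smul_right {n : ℕ} (c : ℂ) (u v : Fin n → ℂ) :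
    hermitianPairing u (c • v) = c * hermitianPairing u v := by
  simp only [hermitianPairing, Finset.mul_sum, Pi.smul_apply, smul_eq_mul]
  exact Finset.sum_congr rfl fun i _ => by ring

theorem hermitianPairing_add_left {n : ℕ} (u u' v : Fin n → ℂ) :
    hermitianPairing (u + u') v = hermitianPairing u v + hermitianPairing u' v := by
  simp [hermitianPairing, add_mul, Finset.sum_add_distrib]

theorem hermitianPairing_smul_left {n : ℕ} (c : ℂ) (u v : Fin n → ℂ) :
    hermitianPairing (c • u) v = conj c * hermitianPairing u v := by
  rw [← conj_hermitianPairing, hermitianPairing_smul_right, map_mul, conj_hermitianPairing]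

theorem imPairing_eq_im_hermitianPairing {ℓ : ℕ} (u v : Fin (ℓ + 1) → ℂ) :
    imPairing ℓ u v = (hermitianPairing u v).im := by
  rw [imPairing_apply, hermitianPairing, Complex.im_sum]

/-- The hermitian pairing splits off the `k`-th coordinate. -/
theorem hermitianPairing_insertNth {ℓ : ℕ} (k : Fin (ℓ + 1)) (a b : ℂ) (u v : Fin ℓ → ℂ) :
    hermitianPairing (k.insertNth (α := fun _ => ℂ) a u) (k.insertNth (α := fun _ => ℂ) b v) =
      conj a * b + hermitianPairing u v := by
  simp [hermitianPairing, Fin.sum_univ_succAbove _ k]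

/-- The linear form `u ↦ ∑_i conj (w_i) u_i`. -/
noncomputable def hermitianDual {n : ℕ} (w : Fin n → ℂ) : Module.Dual ℂ (Fin n → ℂ) where
  toFun := hermitianPairing w
  map_add' := hermitianPairing_add_right w
  map_smul' c u := hermitianPairing_smul_right c w u

/-- The standard symplectic form of `ℂ^ℓ`, as the restriction of `Ω` to the hyperplane of `ℂ^(ℓ+1)`
where the `k`-th coordinate vanishes; it does not depend on `k`. -/
noncomputable def chartSymplecticForm {ℓ : ℕ} (k : Fin (ℓ + 1)) : (Fin ℓ → ℂ) [⋀^Fin 2]→L[ℝ] ℝ :=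
  (symplecticForm ℓ).compContinuousLinearMap (hyperplaneIncl k)

theorem chartSymplecticForm_apply {ℓ : ℕ} (k : Fin (ℓ + 1)) (u v : Fin ℓ → ℂ) :
    chartSymplecticForm k ![u, v] = (hermitianPairing u v).im := by
  change imPairing ℓ (hyperplaneIncl k u) (hyperplaneIncl k v) = _
  rw [imPairing_eq_im_hermitianPairing, hyperplaneIncl_apply, hyperplaneIncl_apply,
    hermitianPairing_insertNth, mul_zero, zero_add]

/-- The standard real frame of `ℂ^ℓ`, as a basis. -/
noncomputable def standardBasis (ℓ : ℕ) : Module.Basis (Fin ℓ × Fin 2) ℝ (Fin ℓ → ℂ) :=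
  Complex.basisOneI.smulTower' (Pi.basisFun ℂ (Fin ℓ))

theorem coe_standardBasis (ℓ : ℕ) : ⇑(standardBasis ℓ) = standardFrame ℓ := by
  ext ⟨i, b⟩ j
  rw [standardBasis, Module.Basis.smulTower'_apply, standardFrame, Pi.basisFun_apply,
    Complex.coe_basisOneI]
  simp [Pi.single_apply]

theorem wedgePower_chartSymplecticForm {ℓ : ℕ} (k : Fin (ℓ + 1)) :
    wedgePower ℓ (chartSymplecticForm k) (standardFrame ℓ) = (Nat.factorial ℓ : ℝ) := by
  refine wedgePower_symplecticFrame _ _ ?_ ?_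
  · intro p q hpq
    rw [chartSymplecticForm_apply, hermitianPairing, Finset.sum_eq_zero, zero_im]
    intro i _
    by_cases h : i = p.1
    · subst h
      simp [standardFrame, hpq]
    · simp [standardFrame, Pi.single_apply, h]
  · intro i
    rw [chartSymplecticForm_apply, hermitianPairing, Finset.sum_eq_single i]
    · simp [standardFrame]
    · intro j _ hj
      simp [standardFrame, hj]
    · simp

/-- The derivative of `a(w) (w_1, …, 1, …, w_ℓ)` with `a(w) = r / √(1 + |w|²)`: the factor `a` has
derivative `-a Re ⟨w, u⟩ / (1 + |w|²)`. -/
theorem hasFDerivAt_sphereLift {ℓ : ℕ} (r : ℝ) (k : Fin (ℓ + 1)) (w : Fin ℓ → ℂ) :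
    ∃ D : (Fin ℓ → ℂ) →L[ℝ] (Fin (ℓ + 1) → ℂ), HasFDerivAt (sphereLift r k) D w ∧
      ∀ u, D u = ((r / √(1 + ∑ i, ‖w i‖ ^ 2) : ℝ) : ℂ) •
        (hyperplaneIncl k u - (((hermitianPairing w u).re / (1 + ∑ i, ‖w i‖ ^ 2) : ℝ) : ℂ) •
          k.insertNth (α := fun _ => ℂ) 1 w) := by
  have hN : (0 : ℝ) < 1 + ∑ i, ‖w i‖ ^ 2 := by positivity
  have hJ : HasFDerivAt (fun w : Fin ℓ → ℂ => k.insertNth (α := fun _ => ℂ) 1 w)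
      (hyperplaneIncl k) w := by
    have : (fun w : Fin ℓ → ℂ => k.insertNth (α := fun _ => ℂ) 1 w) =
        fun w => (Pi.single k 1 : Fin (ℓ + 1) → ℂ) + hyperplaneIncl k w := by
      ext w j
      refine Fin.succAboveCases k ?_ (fun i => ?_) j <;> simp [hyperplaneIncl_apply]
    rw [this]
    exact (hyperplaneIncl k).hasFDerivAt.const_add _
  have hsq (i : Fin ℓ) : HasFDerivAt (fun w : Fin ℓ → ℂ => ‖w i‖ ^ 2)
      (2 • (innerSL ℝ (w i)).comp (ContinuousLinearMap.proj (R := ℝ) (φ := fun _ : Fin ℓ => ℂ) i))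
      w :=
    (ContinuousLinearMap.proj (R := ℝ) (φ := fun _ : Fin ℓ => ℂ) i).hasFDerivAt.norm_sq
  have hsum := (HasFDerivAt.fun_sum (u := Finset.univ) fun i _ => hsq i).const_add (1 : ℝ)
  have hρ := ((hasDerivAt_inv (Real.sqrt_pos.2 hN).ne').comp_hasFDerivAt w
    (hsum.sqrt hN.ne')).const_mul r
  have hD := hρ.smul hJ
  refine ⟨_, hD.congr_of_eventuallyEq (Eventually.of_forall fun x => ?_), fun u => ?_⟩
  · rw [sphereLift, div_eq_mul_inv, Complex.coe_smul]
    rfl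
  · have hre : (hermitianPairing w u).re = ∑ i, inner ℝ (w i) (u i) := by
      rw [hermitianPairing, Complex.re_sum]
      refine Finset.sum_congr rfl fun i _ => ?_
      rw [Complex.inner, mul_comm]
    have hs := Real.sq_sqrt hN.le
    have hs0 := (Real.sqrt_pos.2 hN).ne'
    rw [hre]
    simp only [add_apply, smul_apply,
      ContinuousLinearMap.smulRight_apply, sum_apply,
      ContinuousLinearMap.comp_apply, ContinuousLinearMap.proj_apply, innerSL_apply_apply,
      nsmul_eq_mul, smul_eq_mul, ← Finset.mul_sum, Function.comp_apply, Complex.coe_smul, smul_sub,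
      smul_smul]
    rw [sub_eq_add_neg, ← neg_smul]
    congr 2
    rw [hs]
    push_cast
    field_simp

/-- A square root, up to unitary maps, of the hermitian metric whose imaginary part is the reduced
symplectic form in a standard chart: the map `u ↦ a (u - (N + √N)⁻¹ ⟨w, u⟩ w)` with
`N = 1 + |w|²` and `a = r / √N`. The coefficient `c = (N + √N)⁻¹` solves
`2 c - c² |w|² = 1 / N`. -/
noncomputable def chartRoot {ℓ : ℕ} (r : ℝ) (w : Fin ℓ → ℂ) : (Fin ℓ → ℂ) →ₗ[ℂ] (Fin ℓ → ℂ) :=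
  ((r / √(1 + ∑ i, ‖w i‖ ^ 2) : ℝ) : ℂ) • LinearMap.transvection (hermitianDual w)
    (-(((1 + ∑ i, ‖w i‖ ^ 2 + √(1 + ∑ i, ‖w i‖ ^ 2))⁻¹ : ℝ) : ℂ) • w)

theorem chartRoot_apply {ℓ : ℕ} (r : ℝ) (w u : Fin ℓ → ℂ) :
    chartRoot r w u = ((r / √(1 + ∑ i, ‖w i‖ ^ 2) : ℝ) : ℂ) • (u + hermitianPairing w u •
      (-(((1 + ∑ i, ‖w i‖ ^ 2 + √(1 + ∑ i, ‖w i‖ ^ 2))⁻¹ : ℝ) : ℂ) • w)) := rfl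

theorem det_chartRoot {ℓ : ℕ} (r : ℝ) (w : Fin ℓ → ℂ) :
    LinearMap.det ((chartRoot r w).restrictScalars ℝ) =
      (r ^ 2) ^ ℓ / (1 + ∑ i, ‖w i‖ ^ 2) ^ (ℓ + 1) := by
  have hN : (0 : ℝ) < 1 + ∑ i, ‖w i‖ ^ 2 := by positivity
  have hdual (v : Fin ℓ → ℂ) : hermitianDual w v = hermitianPairing w v := rfl
  rw [LinearMap.det_restrictScalars, Algebra.norm_complex_apply, chartRoot, LinearMap.det_smul,
    LinearMap.transvection.det, hdual, hermitianPairing_smul_right, hermitianPairing_self,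
    Module.finrank_fin_fun]
  set q := √(1 + ∑ i, ‖w i‖ ^ 2) with hq
  have hq2 : 1 + ∑ i, ‖w i‖ ^ 2 = q ^ 2 := (Real.sq_sqrt hN.le).symm
  have hq0 : 0 < q := Real.sqrt_pos.2 hN
  have hS : ∑ i, ‖w i‖ ^ 2 = q ^ 2 - 1 := by linarith
  have hreal : (1 : ℂ) + -(((1 + ∑ i, ‖w i‖ ^ 2 + q)⁻¹ : ℝ) : ℂ) * ((∑ i, ‖w i‖ ^ 2 : ℝ) : ℂ) =
      ((q⁻¹ : ℝ) : ℂ) := by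
    rw [← Complex.ofReal_neg, ← Complex.ofReal_mul, ← Complex.ofReal_one, ← Complex.ofReal_add,
      hq2, hS]
    congr 1
    field_simp
    ring
  rw [hreal, map_mul, map_pow, Complex.normSq_ofReal, Complex.normSq_ofReal, hq2,
    ← pow_two, div_pow, div_pow, ← pow_two, inv_pow, pow_succ (q ^ 2) ℓ]
  field_simp

/-- The reduced symplectic form in a standard chart is the pull back of the standard symplectic
form by `chartRoot`. -/
theorem compContinuousLinearMap_fderiv_sphereLift {ℓ : ℕ} (r : ℝ) (k : Fin (ℓ + 1))
    (w u v : Fin ℓ → ℂ) :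
    (symplecticForm ℓ).compContinuousLinearMap (fderiv ℝ (sphereLift r k) w) ![u, v] =
      chartSymplecticForm k ![chartRoot r w u, chartRoot r w v] := by
  obtain ⟨D, hD, hDu⟩ := hasFDerivAt_sphereLift r k w
  have hN : (0 : ℝ) < 1 + ∑ i, ‖w i‖ ^ 2 := by positivity
  rw [hD.fderiv, chartSymplecticForm_apply]
  change imPairing ℓ (D u) (D v) = _
  rw [hDu, hDu, imPairing_eq_im_hermitianPairing, chartRoot_apply, chartRoot_apply]
  simp only [sub_eq_add_neg, ← neg_smul, hyperplaneIncl_apply, hermitianPairing_add_left,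
    hermitianPairing_add_right, hermitianPairing_smul_left, hermitianPairing_smul_right,
    hermitianPairing_insertNth, map_neg, Complex.conj_ofReal, map_zero, map_one,
    conj_hermitianPairing]
  rw [← conj_hermitianPairing w u, hermitianPairing_self]
  set q := √(1 + ∑ i, ‖w i‖ ^ 2) with hq
  have hq2 : 1 + ∑ i, ‖w i‖ ^ 2 = q ^ 2 := (Real.sq_sqrt hN.le).symm
  have hq0 : 0 < q := Real.sqrt_pos.2 hN
  -- Both sides are `α² (Im ⟨u, v⟩ - x Im (conj ⟨w, u⟩ ⟨w, v⟩))`, with `x = 1 / N` on the left and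
  -- `x = 2 c - c² |w|²` on the right, where `c = (N + √N)⁻¹`.
  have hc : 2 * (1 + ∑ i, ‖w i‖ ^ 2 + q)⁻¹ -
      (1 + ∑ i, ‖w i‖ ^ 2 + q)⁻¹ ^ 2 * ∑ i, ‖w i‖ ^ 2 = (1 + ∑ i, ‖w i‖ ^ 2)⁻¹ := by
    have hS : ∑ i, ‖w i‖ ^ 2 = q ^ 2 - 1 := by linarith
    rw [hq2, hS]
    field_simp
    ring
  simp only [div_eq_mul_inv (hermitianPairing w _).re]
  generalize (1 + ∑ i, ‖w i‖ ^ 2 + q)⁻¹ = c at hc ⊢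
  generalize (1 + ∑ i, ‖w i‖ ^ 2)⁻¹ = κ at hc ⊢
  generalize ∑ i, ‖w i‖ ^ 2 = S at hc ⊢
  generalize r / q = α
  generalize hermitianPairing w u = a
  generalize hermitianPairing w v = b
  generalize hermitianPairing u v = h
  simp only [neg_mul, mul_neg, mul_add, zero_mul, mul_zero, mul_one, zero_add, add_zero, add_im,
    neg_im, mul_im, mul_re, ofReal_re, ofReal_im, conj_re, conj_im, neg_neg,
    neg_zero, sub_zero]
  linear_combination α ^ 2 * (a.re * b.im - a.im * b.re) * hc

theorem wedgePower_reducedForm {ℓ : ℕ} (r : ℝ) (k : Fin (ℓ + 1)) (w : Fin ℓ → ℂ) :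
    wedgePower ℓ ((symplecticForm ℓ).compContinuousLinearMap (fderiv ℝ (sphereLift r k) w))
      (standardFrame ℓ) =
      (r ^ 2) ^ ℓ / (1 + ∑ i, ‖w i‖ ^ 2) ^ (ℓ + 1) * (Nat.factorial ℓ : ℝ) := by
  have h := wedgePower_comp_basis (chartSymplecticForm k) (standardBasis ℓ)
    ((chartRoot r w).restrictScalars ℝ)
  rw [det_chartRoot, coe_standardBasis, wedgePower_chartSymplecticForm] at h
  rw [← h]
  simp only [wedgePower, compContinuousLinearMap_fderiv_sphereLift, LinearMap.coe_restrictScalars]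

/-! ### The equivariant volume as an integral over the charts -/

theorem scale_equivariantChernForm {ℓ : ℕ} {r : ℝ} (hr : r ≠ 0) (σ : Fin (ℓ + 1) → ℝ) :
    (equivariantChernForm ℓ r σ).scale (r ^ 2 / 2) = equivariantSymplecticForm ℓ r σ := by
  refine CartanForm.ext (funext fun p => ?_) (funext fun φ => ?_)
  · induction p using Quotient.inductionOn with
    | h φ =>
      change r ^ 2 / 2 * -connectionForm ℓ r φ ![torusVector σ φ] = ∑ j, σ j * momentum j φ
      rw [connectionForm_apply, imPairing_apply, Matrix.cons_val_zero, mul_neg, ← mul_assoc,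
        Finset.mul_sum, ← Finset.sum_neg_distrib]
      refine Finset.sum_congr rfl fun j _ => ?_
      have : (conj ((φ : Fin (ℓ + 1) → ℂ) j) * torusVector σ φ j).im =
          σ j * ‖(φ : Fin (ℓ + 1) → ℂ) j‖ ^ 2 := by
        rw [← Complex.normSq_eq_norm_sq, Complex.normSq_apply]
        simp [torusVector]
        ring
      rw [this, momentum]
      field_simp
  · change (r ^ 2 / 2) • extDeriv (connectionForm ℓ r) φ = symplecticForm ℓ
    rw [extDeriv_connectionForm, smul_smul]
    have : r ^ 2 / 2 * (2 / r ^ 2) = 1 := by field_simp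
    rw [this, one_smul]

/-- The density of the equivariant volume of the reduced space in the `k`-th standard chart, as a
function of the level `t = r² / 2`. -/
noncomputable def chartDensity {ℓ : ℕ} (σ : Fin (ℓ + 1) → ℝ) (k : Fin (ℓ + 1)) (t : ℝ)
    (w : Fin ℓ → ℂ) : ℝ :=
  (2 * t) ^ ℓ / (1 + ∑ i, ‖w i‖ ^ 2) ^ (ℓ + 2) *
    Real.exp (-(t * ((σ k + ∑ i, σ (k.succAbove i) * ‖w i‖ ^ 2) / (1 + ∑ i, ‖w i‖ ^ 2))))

theorem integralExp_equivariantSymplecticForm {ℓ : ℕ} {r : ℝ} (hr : r ≠ 0)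
    (σ : Fin (ℓ + 1) → ℝ) :
    (equivariantSymplecticForm ℓ r σ).integralExp =
      ∑ k, ∫ w : Fin ℓ → ℂ, chartDensity σ k (r ^ 2 / 2) w := by
  rw [CartanForm.integralExp]
  refine Finset.sum_congr rfl fun k _ => integral_congr_ae (Eventually.of_forall fun w => ?_)
  have hN : (0 : ℝ) < 1 + ∑ i, ‖w i‖ ^ 2 := by positivity
  have hnorm (j) : ‖sphereLift r k w j‖ ^ 2 = r ^ 2 / (1 + ∑ i, ‖w i‖ ^ 2) *
      ‖k.insertNth (α := fun _ => ℂ) 1 w j‖ ^ 2 := by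
    simp only [sphereLift, Pi.smul_apply, smul_eq_mul, norm_mul, mul_pow,
      Complex.norm_real, Real.norm_eq_abs, sq_abs, div_pow, Real.sq_sqrt hN.le]
  have hweight : weight k (param r k w) = (1 + ∑ i, ‖w i‖ ^ 2)⁻¹ := by
    change ‖sphereLift r k w k‖ ^ 2 / r ^ 2 = _
    rw [hnorm, Fin.insertNth_apply_same, norm_one]
    field_simp
  have hdeg0 : (equivariantSymplecticForm ℓ r σ).deg0 (param r k w) =
      -(r ^ 2 / 2 * ((σ k + ∑ i, σ (k.succAbove i) * ‖w i‖ ^ 2) / (1 + ∑ i, ‖w i‖ ^ 2))) := by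
    change ∑ j, σ j * momentum j (sphereLift r k w) = _
    simp only [momentum, hnorm]
    rw [Fin.sum_univ_succAbove _ k]
    simp only [Fin.insertNth_apply_same, Fin.insertNth_apply_succAbove, norm_one, one_pow, mul_one,
      add_div, mul_add, Finset.sum_div, Finset.mul_sum, neg_add, ← Finset.sum_neg_distrib]
    congr 1
    · ring
    · exact Finset.sum_congr rfl fun i _ => by ring
  have htop : wedgePower ℓ ((equivariantSymplecticForm ℓ r σ).coordDeg2 k w) (standardFrame ℓ) =
      (r ^ 2) ^ ℓ / (1 + ∑ i, ‖w i‖ ^ 2) ^ (ℓ + 1) * (Nat.factorial ℓ : ℝ) :=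
    wedgePower_reducedForm r k w
  have hfac : (Nat.factorial ℓ : ℝ) ≠ 0 := by positivity
  simp only [CartanForm.expTop]
  rw [hweight, hdeg0, htop, chartDensity, mul_div_cancel_right₀ _ hfac,
    mul_div_cancel₀ (r ^ 2) (two_ne_zero' ℝ)]
  rw [pow_succ _ (ℓ + 1)]
  field_simp


/-! ### The Laplace transform of the volume in the level -/

/-- The exponent of `chartDensity` is an average of the `σ_j`. -/
theorem chartDensity_exponent_le {ℓ : ℕ} {σ : Fin (ℓ + 1) → ℝ} {m : ℝ} (hm : ∀ j, m ≤ σ j)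
    (k : Fin (ℓ + 1)) (w : Fin ℓ → ℂ) :
    m ≤ (σ k + ∑ i, σ (k.succAbove i) * ‖w i‖ ^ 2) / (1 + ∑ i, ‖w i‖ ^ 2) := by
  rw [le_div_iff₀ (by positivity), mul_add, mul_one, Finset.mul_sum]
  gcongr with i
  · exact hm k
  · exact hm _

/-- The integrand is bounded by `(1 + ‖w‖²)^(-(ℓ+2))` for the sup norm, and `2 (ℓ + 2)` exceeds the
real dimension `2 ℓ`. -/
theorem integrable_inv_one_add_sum_sq_pow (ℓ : ℕ) :
    Integrable fun w : Fin ℓ → ℂ => ((1 + ∑ i, ‖w i‖ ^ 2) ^ (ℓ + 2))⁻¹ := by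
  have hfin : Module.finrank ℝ (Fin ℓ → ℂ) = 2 * ℓ := by
    rw [Module.finrank_pi_fintype]
    simp [mul_comm]
  have h := integrable_rpow_neg_one_add_norm_sq (E := Fin ℓ → ℂ) (μ := volume)
    (r := 2 * (ℓ + 2 : ℕ)) (by rw [hfin]; push_cast; linarith)
  refine h.mono' ?_ (Eventually.of_forall fun w => ?_)
  · refine Continuous.aestronglyMeasurable ?_
    refine Continuous.inv₀ (by fun_prop) fun w => ?_
    positivity
  · have hle : 1 + ‖w‖ ^ 2 ≤ 1 + ∑ i, ‖w i‖ ^ 2 := by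
      gcongr
      rw [← Real.sqrt_le_sqrt_iff (by positivity), Real.sqrt_sq (norm_nonneg w),
        pi_norm_le_iff_of_nonneg (Real.sqrt_nonneg _)]
      intro i
      refine Real.le_sqrt_of_sq_le ?_
      exact Finset.single_le_sum (f := fun i => ‖w i‖ ^ 2) (fun i _ => by positivity)
        (Finset.mem_univ i)
    rw [Real.norm_of_nonneg (by positivity),
      show -(2 * ((ℓ + 2 : ℕ) : ℝ)) / 2 = -((ℓ + 2 : ℕ) : ℝ) by ring,
      Real.rpow_neg (by positivity), Real.rpow_natCast]
    gcongr

theorem continuous_chartDensity {ℓ : ℕ} (σ : Fin (ℓ + 1) → ℝ) (k : Fin (ℓ + 1)) :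
    Continuous fun p : ℝ × (Fin ℓ → ℂ) => chartDensity σ k p.1 p.2 := by
  have hN (p : ℝ × (Fin ℓ → ℂ)) : 1 + ∑ i, ‖p.2 i‖ ^ 2 ≠ 0 := by positivity
  have hN' (p : ℝ × (Fin ℓ → ℂ)) : (1 + ∑ i, ‖p.2 i‖ ^ 2) ^ (ℓ + 2) ≠ 0 := pow_ne_zero _ (hN p)
  unfold chartDensity
  fun_prop (disch := first | exact hN | exact hN')

theorem continuous_integral_chartDensity {ℓ : ℕ} (σ : Fin (ℓ + 1) → ℝ) (k : Fin (ℓ + 1)) :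
    Continuous fun t => ∫ w : Fin ℓ → ℂ, chartDensity σ k t w := by
  rw [continuous_iff_continuousAt]
  intro t
  set M := ∑ j, |σ j|
  have hM (j) : |σ j| ≤ M :=
    Finset.single_le_sum (f := fun j => |σ j|) (fun _ _ => abs_nonneg _) (Finset.mem_univ j)
  refine continuousAt_of_dominated (bound := fun w : Fin ℓ → ℂ =>
    ((2 * (|t| + 1)) ^ ℓ * Real.exp ((|t| + 1) * M)) * ((1 + ∑ i, ‖w i‖ ^ 2) ^ (ℓ + 2))⁻¹) ?_ ?_
    ((integrable_inv_one_add_sum_sq_pow ℓ).const_mul _) ?_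
  · exact Eventually.of_forall fun s => ((continuous_chartDensity σ k).comp
      (Continuous.prodMk_right s)).aestronglyMeasurable
  · have hball : ∀ᶠ s in 𝓝 t, |s| < |t| + 1 :=
      continuous_abs.continuousAt.eventually_lt continuousAt_const (by simp)
    filter_upwards [hball] with s hs
    refine Eventually.of_forall fun w => ?_
    have h1 := chartDensity_exponent_le (σ := σ) (m := -M) (fun j => by
      have := (abs_le.mp (hM j)).1; linarith) k w
    have h2 := chartDensity_exponent_le (σ := -σ) (m := -M) (fun j => by
      have := (abs_le.mp (hM j)).2; simp only [Pi.neg_apply]; linarith) k w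
    have h3 : (((-σ) k + ∑ i, (-σ) (k.succAbove i) * ‖w i‖ ^ 2) / (1 + ∑ i, ‖w i‖ ^ 2)) =
        -((σ k + ∑ i, σ (k.succAbove i) * ‖w i‖ ^ 2) / (1 + ∑ i, ‖w i‖ ^ 2)) := by
      simp only [Pi.neg_apply, neg_mul, Finset.sum_neg_distrib]
      ring
    rw [h3] at h2
    have habs := abs_le.mpr ⟨h1, by linarith⟩
    rw [chartDensity, norm_mul, norm_div, norm_pow, Real.norm_eq_abs, Real.norm_eq_abs (Real.exp _),
      Real.abs_exp, abs_mul, abs_of_pos (two_pos (α := ℝ)), norm_pow,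
      Real.norm_of_nonneg (by positivity),
      div_eq_mul_inv, mul_right_comm]
    gcongr
    rw [← neg_mul]
    refine (le_abs_self _).trans ?_
    rw [abs_mul, abs_neg]
    gcongr
  · exact Eventually.of_forall fun w => ((continuous_chartDensity σ k).comp
      (Continuous.prodMk_left w)).continuousAt

theorem integrableOn_pow_mul_exp_neg_mul (n : ℕ) {c : ℝ} (hc : 0 < c) :
    IntegrableOn (fun t : ℝ => t ^ n * Real.exp (-(c * t))) (Set.Ioi 0) := by
  have h := integrableOn_rpow_mul_exp_neg_mul_rpow (s := n) (p := 1)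
    (lt_of_lt_of_le (by norm_num) n.cast_nonneg) one_pos hc
  simpa only [Real.rpow_natCast, Real.rpow_one, neg_mul] using h

/-- The integrand of the Laplace transform of the volume is absolutely integrable. -/
theorem integrable_exp_mul_chartDensity {ℓ : ℕ} {σ : Fin (ℓ + 1) → ℝ} {s : ℂ}
    (hs : ∀ j, 0 < s.re + σ j) (k : Fin (ℓ + 1)) :
    Integrable (fun p : ℝ × (Fin ℓ → ℂ) => cexp (-(s * p.1)) * (chartDensity σ k p.1 p.2 : ℂ))
      ((volume.restrict (Set.Ioi 0)).prod volume) := by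
  obtain ⟨j₀, hj₀⟩ := Finite.exists_min σ
  have hbound := ((integrableOn_pow_mul_exp_neg_mul ℓ (hs j₀)).const_mul (2 ^ ℓ)).mul_prod
    (integrable_inv_one_add_sum_sq_pow ℓ)
  have hmeas : Continuous fun p : ℝ × (Fin ℓ → ℂ) =>
      cexp (-(s * p.1)) * (chartDensity σ k p.1 p.2 : ℂ) := by
    have := continuous_chartDensity σ k
    fun_prop
  refine hbound.mono' hmeas.aestronglyMeasurable ?_
  have hpos : ∀ᵐ p : ℝ × (Fin ℓ → ℂ) ∂((volume.restrict (Set.Ioi 0)).prod volume), 0 < p.1 :=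
    Measure.quasiMeasurePreserving_fst.ae (ae_restrict_mem measurableSet_Ioi)
  filter_upwards [hpos] with p hp
  have hle := chartDensity_exponent_le hj₀ k p.2
  rw [norm_mul, Complex.norm_exp, Complex.norm_real, chartDensity,
    Real.norm_of_nonneg (by positivity)]
  have hre : (-(s * (p.1 : ℂ))).re = -(s.re * p.1) := by simp
  rw [hre, div_eq_mul_inv, mul_pow, add_mul, neg_add, Real.exp_add]
  have : Real.exp (-(p.1 * ((σ k + ∑ i, σ (k.succAbove i) * ‖p.2 i‖ ^ 2) /
      (1 + ∑ i, ‖p.2 i‖ ^ 2)))) ≤ Real.exp (-(σ j₀ * p.1)) := by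
    rw [mul_comm (σ j₀)]
    gcongr
  calc _ = 2 ^ ℓ * (p.1 ^ ℓ * (Real.exp (-(s.re * p.1)) * Real.exp (-(p.1 * ((σ k +
        ∑ i, σ (k.succAbove i) * ‖p.2 i‖ ^ 2) / (1 + ∑ i, ‖p.2 i‖ ^ 2)))))) *
        ((1 + ∑ i, ‖p.2 i‖ ^ 2) ^ (ℓ + 2))⁻¹ := by ring
    _ ≤ _ := by gcongr

/-- The polar coordinate integral of a radial function on `ℂ`, in terms of `t = |z|² / 2`. -/
theorem integral_complex_radial (f : ℝ → ℂ) :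
    ∫ z : ℂ, f (‖z‖ ^ 2 / 2) = 2 * Real.pi * ∫ t in Set.Ioi (0 : ℝ), f t := by
  rw [integral_fun_norm_addHaar volume fun ρ => f (ρ ^ 2 / 2), Complex.finrank_real_complex,
    measureReal_def, Complex.volume_ball]
  have h := integral_comp_rpow_Ioi_of_pos (g := fun y => f (y / 2)) (p := 2) two_pos
  have h2 := integral_comp_mul_left_Ioi f 0 (b := 1 / 2) (by norm_num)
  simp only [mul_zero, one_div, inv_inv] at h2
  simp only [div_eq_inv_mul] at h ⊢
  rw [h2] at h
  have h3 : ∫ x in Set.Ioi (0 : ℝ), (2 * x ^ ((2 : ℝ) - 1)) • f (2⁻¹ * x ^ (2 : ℝ)) =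
      2 * ∫ x in Set.Ioi (0 : ℝ), x ^ (2 - 1) • f (2⁻¹ * x ^ 2) := by
    rw [← integral_const_mul]
    refine integral_congr_ae (Eventually.of_forall fun x => ?_)
    norm_num
    ring
  rw [h3] at h
  simp only [nsmul_eq_mul, Complex.real_smul] at h ⊢
  simp
  simp only [Nat.add_one_sub_one, pow_one, Complex.ofReal_ofNat] at h
  linear_combination (Real.pi : ℂ) * h

theorem integral_gaussian_torus {n : ℕ} {σ : Fin n → ℝ} {s : ℂ} (hs : ∀ j, 0 < s.re + σ j) :
    Integrable (fun φ : Fin n → ℂ => ∏ j, cexp (-((s + σ j) / 2) * ‖φ j‖ ^ 2)) ∧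
    ∫ φ : Fin n → ℂ, ∏ j, cexp (-((s + σ j) / 2) * ‖φ j‖ ^ 2) =
      (2 * (Real.pi : ℂ)) ^ n / ∏ j, (s + σ j) := by
  have hre (j) : 0 < ((s + σ j) / 2).re := by
    rw [← Complex.ofReal_ofNat, Complex.div_ofReal_re]
    simpa using hs j
  constructor
  · refine Integrable.fintype_prod (μ := fun _ => volume) (f := fun j (z : ℂ) =>
      cexp (-((s + σ j) / 2) * ‖z‖ ^ 2)) fun j => ?_
    simpa using GaussianFourier.integrable_cexp_neg_mul_sq_norm_add (hre j) 0 (0 : ℂ)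
  · rw [integral_fintype_prod_volume_eq_prod (f := fun j (z : ℂ) =>
      cexp (-((s + σ j) / 2) * ‖z‖ ^ 2))]
    have hj (j) : ∫ z : ℂ, cexp (-((s + σ j) / 2) * ‖z‖ ^ 2) = 2 * Real.pi / (s + σ j) := by
      rw [GaussianFourier.integral_cexp_neg_mul_sq_norm (hre j), Complex.finrank_real_complex]
      norm_num
      rw [div_div_eq_mul_div, mul_comm]
    simp only [hj]
    simp [Finset.prod_div_distrib]

/-- The density `H(t, w)` obtained from the Gaussian on `ℂ^(ℓ+1)` by the substitution
`φ_k = z`, `φ_i = |z| w_i`, `t = |z|² / 2`; the factor `(2 t)^ℓ = |z|^(2ℓ)` is its Jacobian. -/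
noncomputable def coneDensity {ℓ : ℕ} (σ : Fin (ℓ + 1) → ℝ) (s : ℂ) (k : Fin (ℓ + 1)) (t : ℝ)
    (w : Fin ℓ → ℂ) : ℂ :=
  (2 * t) ^ ℓ * (1 + ∑ i, (‖w i‖ : ℂ) ^ 2)⁻¹ *
    cexp (-(t * ((s + σ k) + ∑ i, (s + σ (k.succAbove i)) * ‖w i‖ ^ 2)))

/-- For fixed `φ_k = z`, the substitution of `|z| w` for the other coordinates. Scaling by `|z|`
instead of `z` is enough, as the integrand depends only on absolute values. -/
theorem integral_weight_gaussian_fiber {ℓ : ℕ} (σ : Fin (ℓ + 1) → ℝ) (s : ℂ) (k : Fin (ℓ + 1))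
    {z : ℂ} (hz : z ≠ 0) :
    ∫ w : Fin ℓ → ℂ, ((‖z‖ : ℂ) ^ 2 / ((‖z‖ : ℂ) ^ 2 + ∑ i, (‖w i‖ : ℂ) ^ 2)) *
      (cexp (-((s + σ k) / 2) * ‖z‖ ^ 2) *
        ∏ i, cexp (-((s + σ (k.succAbove i)) / 2) * ‖w i‖ ^ 2)) =
      ∫ w : Fin ℓ → ℂ, coneDensity σ s k (‖z‖ ^ 2 / 2) w := by
  have hz0 : 0 < ‖z‖ := norm_pos_iff.2 hz
  have hzc : (‖z‖ : ℂ) ≠ 0 := by exact_mod_cast hz0.ne'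
  have hfin : Module.finrank ℝ (Fin ℓ → ℂ) = 2 * ℓ := by
    rw [Module.finrank_pi_fintype]
    simp [mul_comm]
  have h := Measure.integral_comp_smul_of_nonneg (volume : Measure (Fin ℓ → ℂ))
    (fun w : Fin ℓ → ℂ => ((‖z‖ : ℂ) ^ 2 / ((‖z‖ : ℂ) ^ 2 + ∑ i, (‖w i‖ : ℂ) ^ 2)) *
      (cexp (-((s + σ k) / 2) * ‖z‖ ^ 2) *
        ∏ i, cexp (-((s + σ (k.succAbove i)) / 2) * ‖w i‖ ^ 2))) ‖z‖ (hR := norm_nonneg z)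
  rw [hfin, eq_inv_smul_iff₀ (by positivity)] at h
  rw [← h, ← integral_smul]
  refine integral_congr_ae (Eventually.of_forall fun w => ?_)
  have hN : (0 : ℝ) < 1 + ∑ i, ‖w i‖ ^ 2 := by positivity
  have hNc : 1 + ∑ i, (‖w i‖ : ℂ) ^ 2 ≠ 0 := by exact_mod_cast hN.ne'
  simp only [Pi.smul_apply, norm_smul, norm_norm, Complex.ofReal_mul, mul_pow, ← Finset.mul_sum]
  rw [← Complex.exp_sum, ← Complex.exp_add, coneDensity, Complex.real_smul]
  have hexp : -((s + σ k) / 2) * (‖z‖ : ℂ) ^ 2 +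
      ∑ i, -((s + σ (k.succAbove i)) / 2) * ((‖z‖ : ℂ) ^ 2 * (‖w i‖ : ℂ) ^ 2) =
      -(((‖z‖ ^ 2 / 2 : ℝ) : ℂ) *
        ((s + σ k) + ∑ i, (s + σ (k.succAbove i)) * (‖w i‖ : ℂ) ^ 2)) := by
    rw [mul_add, neg_add, Finset.mul_sum, ← Finset.sum_neg_distrib]
    push_cast
    congr 1
    · ring
    · exact Finset.sum_congr rfl fun i _ => by ring
  rw [hexp, ← mul_assoc]
  congr 1
  push_cast
  rw [mul_div_cancel₀ _ (two_ne_zero' ℂ), ← pow_mul,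
    show (‖z‖ : ℂ) ^ 2 + (‖z‖ : ℂ) ^ 2 * ∑ i, (‖w i‖ : ℂ) ^ 2 =
      (‖z‖ : ℂ) ^ 2 * (1 + ∑ i, (‖w i‖ : ℂ) ^ 2) by ring]
  field_simp

/-- The rescaling `t ↦ t / (1 + |w|²)` turns `coneDensity` into the integrand of the Laplace
transform. -/
theorem coneDensity_rescale {ℓ : ℕ} (σ : Fin (ℓ + 1) → ℝ) (s : ℂ) (k : Fin (ℓ + 1)) (t : ℝ)
    (w : Fin ℓ → ℂ) :
    (1 + ∑ i, ‖w i‖ ^ 2)⁻¹ • coneDensity σ s k ((1 + ∑ i, ‖w i‖ ^ 2)⁻¹ * t) w =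
      cexp (-(s * t)) * (chartDensity σ k t w : ℂ) := by
  have hN : (0 : ℝ) < 1 + ∑ i, ‖w i‖ ^ 2 := by positivity
  have hNc : 1 + ∑ i, (‖w i‖ : ℂ) ^ 2 ≠ 0 := by exact_mod_cast hN.ne'
  have hexp : cexp (-((((1 + ∑ i, ‖w i‖ ^ 2)⁻¹ * t : ℝ) : ℂ) *
      ((s + σ k) + ∑ i, (s + σ (k.succAbove i)) * ‖w i‖ ^ 2))) = cexp (-(s * t)) *
      cexp (-(t * ((σ k + ∑ i, σ (k.succAbove i) * ‖w i‖ ^ 2) / (1 + ∑ i, ‖w i‖ ^ 2)))) := by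
    rw [← Complex.exp_add]
    congr 1
    simp only [add_mul, Finset.sum_add_distrib, ← Finset.mul_sum]
    push_cast
    field_simp
    ring
  rw [coneDensity, hexp, chartDensity, Complex.real_smul]
  push_cast
  rw [mul_left_comm (2 : ℂ), mul_pow ((1 + ∑ i, (‖w i‖ : ℂ) ^ 2)⁻¹), inv_pow, pow_add _ ℓ 2]
  field_simp

theorem integral_coneDensity_Ioi {ℓ : ℕ} (σ : Fin (ℓ + 1) → ℝ) (s : ℂ) (k : Fin (ℓ + 1))
    (w : Fin ℓ → ℂ) :
    ∫ t in Set.Ioi (0 : ℝ), coneDensity σ s k t w =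
      ∫ t in Set.Ioi (0 : ℝ), cexp (-(s * t)) * (chartDensity σ k t w : ℂ) := by
  have hN : (0 : ℝ) < (1 + ∑ i, ‖w i‖ ^ 2)⁻¹ := by positivity
  have h := integral_comp_mul_left_Ioi' (fun t => coneDensity σ s k t w) 0 hN
  rw [mul_zero] at h
  rw [← h, ← integral_smul]
  simp only [coneDensity_rescale]

/-- For fixed `w` the rescaling of `t` gives the norm of `coneDensity` the same integral over `t` as
that of the integrand of the Laplace transform, which is integrable. -/
theorem integrable_coneDensity {ℓ : ℕ} {σ : Fin (ℓ + 1) → ℝ} {s : ℂ}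
    (hs : ∀ j, 0 < s.re + σ j) (k : Fin (ℓ + 1)) :
    Integrable (fun p : ℝ × (Fin ℓ → ℂ) => coneDensity σ s k p.1 p.2)
      ((volume.restrict (Set.Ioi 0)).prod volume) := by
  have hmeas : Continuous fun p : ℝ × (Fin ℓ → ℂ) => coneDensity σ s k p.1 p.2 := by
    have hN (p : ℝ × (Fin ℓ → ℂ)) : 1 + ∑ i, (‖p.2 i‖ : ℂ) ^ 2 ≠ 0 := by
      have : (0 : ℝ) < 1 + ∑ i, ‖p.2 i‖ ^ 2 := by positivity
      exact_mod_cast this.ne'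
    unfold coneDensity
    fun_prop (disch := exact hN)
  have h := integrable_exp_mul_chartDensity hs k
  rw [integrable_prod_iff' h.aestronglyMeasurable] at h
  rw [integrable_prod_iff' hmeas.aestronglyMeasurable]
  constructor
  · filter_upwards [h.1] with w hw
    have hN : (0 : ℝ) < (1 + ∑ i, ‖w i‖ ^ 2)⁻¹ := by positivity
    simp only [← coneDensity_rescale] at hw
    have hw' := (integrable_fun_smul_iff hN.ne' _).1 hw
    have := (integrableOn_Ioi_comp_mul_left_iff (fun t => coneDensity σ s k t w) 0 hN).1 hw'
    rwa [mul_zero] at this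
  · refine h.2.congr (Eventually.of_forall fun w => ?_)
    have hN : (0 : ℝ) < (1 + ∑ i, ‖w i‖ ^ 2)⁻¹ := by positivity
    have h := integral_comp_mul_left_Ioi' (fun t => ‖coneDensity σ s k t w‖) 0 hN
    rw [mul_zero] at h
    simp only [← coneDensity_rescale, norm_smul, Real.norm_of_nonneg hN.le]
    rw [← h, ← integral_smul]
    rfl

theorem integrable_weight_gaussian {n : ℕ} {σ : Fin n → ℝ} {s : ℂ}
    (hs : ∀ j, 0 < s.re + σ j) (k : Fin n) :
    Integrable fun φ : Fin n → ℂ => ((‖φ k‖ : ℂ) ^ 2 / ∑ j, (‖φ j‖ : ℂ) ^ 2) *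
      ∏ j, cexp (-((s + σ j) / 2) * ‖φ j‖ ^ 2) := by
  refine (integral_gaussian_torus hs).1.mono (Measurable.aestronglyMeasurable (by fun_prop))
    (Eventually.of_forall fun φ => ?_)
  rw [norm_mul]
  refine mul_le_of_le_one_left (norm_nonneg _) ?_
  have h : (‖φ k‖ : ℂ) ^ 2 / ∑ j, (‖φ j‖ : ℂ) ^ 2 =
      ((‖φ k‖ ^ 2 / ∑ j, ‖φ j‖ ^ 2 : ℝ) : ℂ) := by push_cast; rfl
  rw [h, Complex.norm_real, Real.norm_of_nonneg (by positivity)]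
  refine div_le_one_of_le₀ ?_ (by positivity)
  exact Finset.single_le_sum (f := fun j => ‖φ j‖ ^ 2) (fun j _ => by positivity)
    (Finset.mem_univ k)

/-- The contribution of the `k`-th chart to the Gaussian integral over `ℂ^(ℓ+1)` is, up to the length
`2π` of the fibres, its contribution to the Laplace transform of the volume. -/
theorem integral_weight_gaussian {ℓ : ℕ} {σ : Fin (ℓ + 1) → ℝ} {s : ℂ}
    (hs : ∀ j, 0 < s.re + σ j) (k : Fin (ℓ + 1)) :
    ∫ φ : Fin (ℓ + 1) → ℂ, ((‖φ k‖ : ℂ) ^ 2 / ∑ j, (‖φ j‖ : ℂ) ^ 2) *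
      ∏ j, cexp (-((s + σ j) / 2) * ‖φ j‖ ^ 2) =
      2 * Real.pi * ∫ t in Set.Ioi (0 : ℝ),
        cexp (-(s * t)) * ((∫ w : Fin ℓ → ℂ, chartDensity σ k t w : ℝ) : ℂ) := by
  have hmp := (volume_preserving_piFinSuccAbove (fun _ : Fin (ℓ + 1) => ℂ) k).symm
  have hint := (hmp.integrable_comp_emb (MeasurableEquiv.measurableEmbedding _)).2
    (integrable_weight_gaussian hs k)
  rw [← hmp.integral_comp']
  refine (integral_prod _ hint).trans ?_
  have hz : ∀ᵐ z : ℂ, z ≠ 0 := Measure.ae_ne volume 0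
  calc _ = ∫ z : ℂ, ∫ w : Fin ℓ → ℂ, coneDensity σ s k (‖z‖ ^ 2 / 2) w := by
        refine integral_congr_ae ?_
        filter_upwards [hz] with z hz
        rw [← integral_weight_gaussian_fiber σ s k hz]
        refine integral_congr_ae (Eventually.of_forall fun w => ?_)
        simp only [Function.comp_apply, MeasurableEquiv.piFinSuccAbove_symm_apply,
          Fin.sum_univ_succAbove _ k,
          Fin.prod_univ_succAbove _ k, Fin.insertNthEquiv_apply, Fin.insertNth_apply_same,
          Fin.insertNth_apply_succAbove]
    _ = 2 * Real.pi * ∫ t in Set.Ioi (0 : ℝ), ∫ w : Fin ℓ → ℂ, coneDensity σ s k t w :=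
        integral_complex_radial fun t => ∫ w : Fin ℓ → ℂ, coneDensity σ s k t w
    _ = 2 * Real.pi * ∫ t in Set.Ioi (0 : ℝ), ∫ w : Fin ℓ → ℂ,
          cexp (-(s * t)) * (chartDensity σ k t w : ℂ) := by
        have h1 := integral_integral_swap (f := coneDensity σ s k) (integrable_coneDensity hs k)
        have h2 := integral_integral_swap
          (f := fun (t : ℝ) w => cexp (-(s * t)) * (chartDensity σ k t w : ℂ))
          (integrable_exp_mul_chartDensity hs k)
        -- Integrating over `t` first allows the rescaling of `t` by a factor that depends on `w`.
        rw [h1, h2]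
        simp only [integral_coneDensity_Ioi]
    _ = _ := by
        simp only [integral_const_mul, integral_complex_ofReal]

/-- The equivariant volume of the reduced space at the level `t = r² / 2`. -/
noncomputable def levelVolume {ℓ : ℕ} (σ : Fin (ℓ + 1) → ℝ) (t : ℝ) : ℝ :=
  ∑ k, ∫ w : Fin ℓ → ℂ, chartDensity σ k t w

theorem continuous_levelVolume {ℓ : ℕ} (σ : Fin (ℓ + 1) → ℝ) : Continuous (levelVolume σ) :=
  continuous_finsetSum _ fun k _ => continuous_integral_chartDensity σ k

theorem integrableOn_exp_mul_integral_chartDensity {ℓ : ℕ} {σ : Fin (ℓ + 1) → ℝ} {s : ℂ}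
    (hs : ∀ j, 0 < s.re + σ j) (k : Fin (ℓ + 1)) :
    IntegrableOn (fun t : ℝ => cexp (-(s * t)) *
      ((∫ w : Fin ℓ → ℂ, chartDensity σ k t w : ℝ) : ℂ)) (Set.Ioi 0) := by
  have h := (integrable_exp_mul_chartDensity hs k).integral_prod_left
  simpa only [IntegrableOn, integral_const_mul, integral_complex_ofReal] using h

theorem integrableOn_exp_mul_levelVolume {ℓ : ℕ} {σ : Fin (ℓ + 1) → ℝ} {s : ℂ}
    (hs : ∀ j, 0 < s.re + σ j) :
    IntegrableOn (fun t : ℝ => cexp (-(s * t)) * (levelVolume σ t : ℂ)) (Set.Ioi 0) := by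
  simp only [levelVolume, Complex.ofReal_sum, Finset.mul_sum]
  exact integrable_finsetSum _ fun k _ => integrableOn_exp_mul_integral_chartDensity hs k

/-- The Laplace transform of the volume in the level is computed by a Gaussian integral over
`ℂ^(ℓ+1)`, which is fibred by the level sets. -/
theorem laplace_levelVolume {ℓ : ℕ} {σ : Fin (ℓ + 1) → ℝ} {s : ℂ} (hs : ∀ j, 0 < s.re + σ j) :
    ∫ t in Set.Ioi (0 : ℝ), cexp (-(s * t)) * (levelVolume σ t : ℂ) =
      (2 * (Real.pi : ℂ)) ^ ℓ / ∏ j, (s + σ j) := by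
  have hpi : (2 * (Real.pi : ℂ)) ≠ 0 := by simp [Real.pi_ne_zero]
  have h0 : ∀ᵐ φ : Fin (ℓ + 1) → ℂ, φ ≠ 0 := Measure.ae_ne volume 0
  have hsum : ∑ k, ∫ φ : Fin (ℓ + 1) → ℂ, ((‖φ k‖ : ℂ) ^ 2 / ∑ j, (‖φ j‖ : ℂ) ^ 2) *
      ∏ j, cexp (-((s + σ j) / 2) * ‖φ j‖ ^ 2) =
      (2 * (Real.pi : ℂ)) ^ (ℓ + 1) / ∏ j, (s + σ j) := by
    rw [← integral_finsetSum _ fun k _ => integrable_weight_gaussian hs k,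
      ← (integral_gaussian_torus hs).2]
    refine integral_congr_ae ?_
    filter_upwards [h0] with φ hφ
    rw [← Finset.sum_mul, ← Finset.sum_div, div_self, one_mul]
    -- The weights sum to `1` away from the origin only.
    obtain ⟨i, hi⟩ := Function.ne_iff.1 hφ
    have : (0 : ℝ) < ∑ j, ‖φ j‖ ^ 2 :=
      Finset.sum_pos' (fun j _ => by positivity) ⟨i, Finset.mem_univ i, by
        have := norm_pos_iff.2 hi
        positivity⟩
    exact_mod_cast this.ne'
  simp only [integral_weight_gaussian hs, ← Finset.mul_sum] at hsum
  simp only [levelVolume, Complex.ofReal_sum, Finset.mul_sum]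
  rw [integral_finsetSum _ fun k _ => integrableOn_exp_mul_integral_chartDensity hs k]
  refine mul_left_cancel₀ hpi (hsum.trans ?_)
  ring


/-! ### Inversion of the Laplace transform -/

/-- The Laplace transform on a vertical line is a Fourier transform, so the Fourier inversion
theorem recovers the function at points of continuity. -/
theorem laplace_inversion {f : ℝ → ℂ} {F : ℝ → ℂ} {ε t : ℝ} (ht : 0 < t)
    (hf : IntegrableOn (fun τ : ℝ => cexp (-(ε * τ)) * f τ) (Set.Ioi 0))
    (hc : ContinuousAt f t)
    (hF : ∀ x : ℝ, ∫ τ in Set.Ioi (0 : ℝ), cexp (-((ε + x * I) * τ)) * f τ = F x)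
    (hFi : Integrable F) :
    ∫ x : ℝ, cexp ((ε + x * I) * t) * F x = 2 * Real.pi * f t := by
  set g : ℝ → ℂ := (Set.Ioi 0).indicator fun τ : ℝ => cexp (-(ε * τ)) * f τ with hg
  have hgi : Integrable g := hf.integrable_indicator measurableSet_Ioi
  have hgF : FourierTransform.fourier g = fun ξ : ℝ => F (2 * Real.pi * ξ) := by
    ext ξ
    rw [Real.fourier_real_eq_integral_exp_smul, ← hF, ← integral_indicator measurableSet_Ioi]
    refine integral_congr_ae (Eventually.of_forall fun τ => ?_)
    by_cases hτ : τ ∈ Set.Ioi (0 : ℝ)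
    · simp only [hg, Set.indicator_of_mem hτ, smul_eq_mul]
      rw [← mul_assoc, ← Complex.exp_add]
      congr 2
      push_cast
      ring
    · simp only [hg, Set.indicator_of_notMem hτ, smul_zero]
  have h2pi : (2 * Real.pi : ℝ) ≠ 0 := by positivity
  have hgc : ContinuousAt g t := by
    have h1 : ContinuousAt (fun τ : ℝ => cexp (-(ε * τ)) * f τ) t := by fun_prop
    refine h1.congr ?_
    filter_upwards [Ioi_mem_nhds ht] with τ hτ
    rw [hg, Set.indicator_of_mem hτ]
  have hinv := hgi.fourierInv_fourier_eq (by rw [hgF]; exact hFi.comp_mul_left' h2pi) hgc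
  rw [hgF, Real.fourierInv_eq', hg, Set.indicator_of_mem (show t ∈ Set.Ioi (0 : ℝ) from ht)] at hinv
  have hscale := Measure.integral_comp_mul_left
    (fun x : ℝ => cexp ((ε + x * I) * t) * F x) (2 * Real.pi)
  have hexp : ∫ ξ : ℝ, cexp ((ε + ((2 * Real.pi * ξ : ℝ) : ℂ) * I) * t) * F (2 * Real.pi * ξ) =
      f t := by
    calc _ = ∫ ξ : ℝ, cexp (ε * t) *
          (cexp (((2 * Real.pi * inner ℝ ξ t : ℝ) : ℂ) * I) • F (2 * Real.pi * ξ)) := by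
          refine integral_congr_ae (Eventually.of_forall fun ξ => ?_)
          simp only [smul_eq_mul]
          rw [← mul_assoc, ← Complex.exp_add]
          congr 2
          simp
          ring
      _ = _ := by
          rw [integral_const_mul, hinv, ← mul_assoc, ← Complex.exp_add, add_neg_cancel,
            Complex.exp_zero, one_mul]
  rw [hexp, abs_of_pos (by positivity), eq_inv_smul_iff₀ h2pi] at hscale
  rw [← hscale, Complex.real_smul]
  push_cast
  ring

/-- At least two factors, each of size at least a multiple of `√(1 + x²)`. -/
theorem integrable_inv_prod {ℓ : ℕ} (hℓ : 1 ≤ ℓ) {b : Fin (ℓ + 1) → ℝ} (hb : ∀ j, 0 < b j) :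
    Integrable fun x : ℝ => (∏ j, ((b j : ℂ) + x * I))⁻¹ := by
  have hne (j) (x : ℝ) : (b j : ℂ) + x * I ≠ 0 := by
    intro h
    have := congrArg Complex.re h
    simp at this
    exact (hb j).ne' this
  have hcont : Continuous fun x : ℝ => (∏ j, ((b j : ℂ) + x * I))⁻¹ :=
    Continuous.inv₀ (by fun_prop) fun x => Finset.prod_ne_zero_iff.2 fun j _ => hne j x
  refine (integrable_inv_one_add_sq.const_mul (∏ j, min 1 (b j))⁻¹).mono'
    hcont.aestronglyMeasurable (Eventually.of_forall fun x => ?_)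
  have hc (j) : 0 < min 1 (b j) := lt_min one_pos (hb j)
  have hfac (j) : min 1 (b j) * √(1 + x ^ 2) ≤ ‖(b j : ℂ) + x * I‖ := by
    rw [Complex.norm_add_mul_I]
    refine Real.le_sqrt_of_sq_le ?_
    rw [mul_pow, Real.sq_sqrt (by positivity), mul_add, mul_one]
    have h1 : min 1 (b j) ^ 2 ≤ b j ^ 2 := pow_le_pow_left₀ (hc j).le (min_le_right _ _) 2
    have h2 : min 1 (b j) ^ 2 ≤ 1 := pow_le_one₀ (hc j).le (min_le_left _ _)
    have h3 := mul_le_of_le_one_left (sq_nonneg x) h2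
    linarith
  rw [norm_inv, ← mul_inv, norm_prod]
  have hprod : 0 < ∏ j, min 1 (b j) := Finset.prod_pos fun j _ => hc j
  refine inv_anti₀ (by positivity) ?_
  calc (∏ j, min 1 (b j)) * (1 + x ^ 2) = (∏ j, min 1 (b j)) * √(1 + x ^ 2) ^ 2 := by
        rw [Real.sq_sqrt (by positivity)]
    _ ≤ (∏ j, min 1 (b j)) * √(1 + x ^ 2) ^ (ℓ + 1) := by
        gcongr
        · exact Real.one_le_sqrt.2 (by nlinarith)
        · omega
    _ = ∏ j, (min 1 (b j) * √(1 + x ^ 2)) := by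
        simp [Finset.prod_mul_distrib]
    _ ≤ _ := Finset.prod_le_prod (fun j _ => by have := hc j; positivity) fun j _ => hfac j

theorem integral_mul_exp_neg_mul_Ioi {z : ℂ} (hz : 0 < z.re) :
    ∫ τ in Set.Ioi (0 : ℝ), (τ : ℂ) * cexp (-(z * τ)) = z⁻¹ ^ 2 := by
  have hz0 : z ≠ 0 := by
    rintro rfl
    simp at hz
  have hnorm (τ : ℝ) : ‖cexp (-(z * τ))‖ = Real.exp (-z.re * τ) := by
    rw [Complex.norm_exp]
    simp
  have hderiv (τ : ℝ) : HasDerivAt (fun τ : ℝ => -((τ * z⁻¹ + z⁻¹ ^ 2) * cexp (-(z * τ))))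
      ((τ : ℂ) * cexp (-(z * τ))) τ := by
    have hid : HasDerivAt (fun τ : ℝ => (τ : ℂ)) 1 τ := (hasDerivAt_id τ).ofReal_comp
    refine (((hid.mul_const z⁻¹).add_const (z⁻¹ ^ 2)).mul
      (hid.const_mul z).fun_neg.cexp).fun_neg.congr_deriv ?_
    field_simp
    ring
  have hint : IntegrableOn (fun τ : ℝ => (τ : ℂ) * cexp (-(z * τ))) (Set.Ioi 0) := by
    refine (integrableOn_pow_mul_exp_neg_mul 1 hz).mono'
      (Continuous.aestronglyMeasurable (by fun_prop)) ?_
    filter_upwards [ae_restrict_mem measurableSet_Ioi] with τ hτ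
    rw [norm_mul, hnorm, Complex.norm_real, Real.norm_of_nonneg (le_of_lt hτ), pow_one, neg_mul]
  have hlim : Tendsto (fun τ : ℝ => -((τ * z⁻¹ + z⁻¹ ^ 2) * cexp (-(z * τ)))) atTop (𝓝 0) := by
    have h1 := (tendsto_rpow_mul_exp_neg_mul_atTop_nhds_zero 1 z.re hz).const_mul ‖z⁻¹‖
    have h0 := (tendsto_rpow_mul_exp_neg_mul_atTop_nhds_zero 0 z.re hz).const_mul ‖z⁻¹ ^ 2‖
    refine squeeze_zero_norm' ?_ (by simpa using h1.add h0)
    filter_upwards [eventually_ge_atTop 0] with τ hτ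
    rw [norm_neg, add_mul]
    refine (norm_add_le _ _).trans (le_of_eq ?_)
    simp only [norm_mul, hnorm, Complex.norm_real, Real.norm_of_nonneg hτ]
    simp
    ring
  rw [integral_Ioi_of_hasDerivAt_of_tendsto (hderiv 0).continuousAt.continuousWithinAt
    (fun τ _ => hderiv τ) hint hlim]
  simp

/-- The case of a single pole, where the inversion integral converges only conditionally. An
integration by parts reduces it to the inversion of the Laplace transform `(s + σ)⁻²` of
`τ e^(-σ τ)`. -/
theorem tendsto_integral_exp_div {ε σ t : ℝ} (ht : 0 < t) (hb : 0 < ε + σ) :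
    Tendsto (fun R : ℝ × ℝ => ∫ x in (-R.1)..R.2,
        cexp ((ε + x * I) * t) * (((ε + σ : ℝ) : ℂ) + x * I)⁻¹)
      (atTop ×ˢ atTop) (𝓝 (2 * Real.pi * cexp (-(σ * t)))) := by
  set b : ℝ := ε + σ with hbdef
  have hne (x : ℝ) : (b : ℂ) + x * I ≠ 0 := by
    intro h
    have := congrArg Complex.re h
    simp at this
    exact hb.ne' this
  have htc : (t : ℂ) ≠ 0 := by exact_mod_cast ht.ne'
  -- `u` is the boundary term of the integration by parts.
  set u : ℝ → ℂ := fun x => cexp ((ε + x * I) * t) * ((b : ℂ) + x * I)⁻¹ / (I * t) with hu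
  set F : ℝ → ℂ := fun x => (((b : ℂ) + x * I)⁻¹) ^ 2 with hF
  have hFi : Integrable F := by
    have := integrable_inv_prod (ℓ := 1) le_rfl (b := fun _ => b) fun _ => hb
    refine this.congr (Eventually.of_forall fun x => ?_)
    simp [hF]
  have hexp (x : ℝ) : ‖cexp ((ε + x * I) * t)‖ = Real.exp (ε * t) := by
    rw [Complex.norm_exp]
    simp
  have hderiv (x : ℝ) : HasDerivAt u (cexp ((ε + x * I) * t) * ((b : ℂ) + x * I)⁻¹ -
      (t : ℂ)⁻¹ * (cexp ((ε + x * I) * t) * F x)) x := by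
    have hx (a : ℝ) : HasDerivAt (fun x : ℝ => (a : ℂ) + x * I) I x := by
      simpa using ((hasDerivAt_id x).ofReal_comp.mul_const I).const_add (a : ℂ)
    have h1 := ((hx ε).mul_const (t : ℂ)).cexp
    have h2 := (hx b).fun_inv (hne x)
    refine ((h1.mul h2).div_const (I * t)).congr_deriv ?_
    have := hne x
    simp only [hF]
    field_simp
    ring
  have hcont1 : Continuous fun x : ℝ => cexp ((ε + x * I) * t) * ((b : ℂ) + x * I)⁻¹ :=
    Continuous.mul (by fun_prop) (Continuous.inv₀ (by fun_prop) hne)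
  have hcont2 : Continuous fun x : ℝ => cexp ((ε + x * I) * t) * F x :=
    Continuous.mul (by fun_prop) ((Continuous.inv₀ (by fun_prop) hne).pow 2)
  have hint2 : Integrable fun x : ℝ => cexp ((ε + x * I) * t) * F x := by
    refine hFi.bdd_mul (c := Real.exp (ε * t)) (Continuous.aestronglyMeasurable (by fun_prop)) ?_
    exact Eventually.of_forall fun x => (hexp x).le
  have hparts (p q : ℝ) : ∫ x in p..q, cexp ((ε + x * I) * t) * ((b : ℂ) + x * I)⁻¹ =
      u q - u p + (t : ℂ)⁻¹ * ∫ x in p..q, cexp ((ε + x * I) * t) * F x := by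
    have h := intervalIntegral.integral_eq_sub_of_hasDerivAt (a := p) (b := q)
      (fun x _ => hderiv x)
      ((hcont1.sub (hcont2.const_mul ((t : ℂ)⁻¹))).intervalIntegrable p q)
    rw [intervalIntegral.integral_sub (hcont1.intervalIntegrable p q)
      ((hcont2.const_mul ((t : ℂ)⁻¹)).intervalIntegrable p q),
      intervalIntegral.integral_const_mul] at h
    rw [← h]
    ring
  have hu0 (l : Filter ℝ) (hl : Tendsto (fun x : ℝ => |x|) l atTop) : Tendsto u l (𝓝 0) := by
    rw [tendsto_zero_iff_norm_tendsto_zero]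
    have hlim : Tendsto (fun x : ℝ => Real.exp (ε * t) / t * |x|⁻¹) l (𝓝 0) := by
      simpa using (tendsto_inv_atTop_zero.comp hl).const_mul (Real.exp (ε * t) / t)
    refine squeeze_zero' (Eventually.of_forall fun x => norm_nonneg _) ?_ hlim
    filter_upwards [hl.eventually_gt_atTop 0] with x hx
    have hle : |x| ≤ ‖(b : ℂ) + x * I‖ := by
      simpa using Complex.abs_im_le_norm ((b : ℂ) + x * I)
    simp only [hu]
    rw [norm_div, norm_mul, hexp, norm_inv, norm_mul, Complex.norm_I, one_mul, Complex.norm_real,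
      Real.norm_of_nonneg ht.le, div_mul_eq_mul_div]
    gcongr
  have hval : ∫ x : ℝ, cexp ((ε + x * I) * t) * F x = 2 * Real.pi * (t * cexp (-(σ * t))) := by
    refine laplace_inversion (f := fun τ : ℝ => (τ : ℂ) * cexp (-(σ * τ))) ht ?_
      (by fun_prop) ?_ hFi
    · refine (integrableOn_pow_mul_exp_neg_mul 1 hb).ofReal.congr
        (Eventually.of_forall fun τ => ?_)
      change ((τ ^ 1 * Real.exp (-(b * τ)) : ℝ) : ℂ) =
        cexp (-(ε * τ)) * ((τ : ℂ) * cexp (-(σ * τ)))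
      rw [mul_left_comm, ← Complex.exp_add, pow_one, hbdef, Complex.ofReal_mul, Complex.ofReal_exp]
      congr 2
      push_cast
      ring
    · intro x
      have hre : 0 < ((b : ℂ) + x * I).re := by simpa using hb
      simp only [hF]
      rw [← integral_mul_exp_neg_mul_Ioi hre]
      refine integral_congr_ae (Eventually.of_forall fun τ => ?_)
      simp only
      rw [mul_left_comm, ← Complex.exp_add, hbdef]
      congr 2
      push_cast
      ring
  have hR1 : Tendsto (fun R : ℝ × ℝ => -R.1) (atTop ×ˢ atTop) atBot :=
    tendsto_neg_atTop_atBot.comp tendsto_fst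
  have hR2 : Tendsto (fun R : ℝ × ℝ => R.2) (atTop ×ˢ atTop) atTop := tendsto_snd
  have hlim := (((hu0 _ tendsto_abs_atTop_atTop).comp hR2).sub
    ((hu0 _ tendsto_abs_atBot_atTop).comp hR1)).add
    ((intervalIntegral_tendsto_integral hint2 hR1 hR2).const_mul ((t : ℂ)⁻¹))
  rw [hval] at hlim
  have hval' : 0 - 0 + (t : ℂ)⁻¹ * (2 * Real.pi * (t * cexp (-(σ * t)))) =
      2 * Real.pi * cexp (-(σ * t)) := by
    field_simp
    ring
  rw [hval'] at hlim
  exact hlim.congr fun R => (hparts _ _).symm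


/-! ### The contour integral -/

theorem contourIntegrand_shift {ℓ : ℕ} (r : ℝ) (σ : Fin (ℓ + 1) → ℝ) (ε x : ℝ) :
    contourIntegrand r σ ((x : ℂ) - I * (ε : ℂ)) =
      cexp ((ε + x * I) * ((r ^ 2 / 2 : ℝ) : ℂ)) *
        (∏ j, (((ε + σ j : ℝ) : ℂ) + x * I))⁻¹ := by
  rw [contourIntegrand, div_eq_mul_inv]
  congr 2
  · push_cast
    linear_combination (-(ε * r ^ 2 / 2) : ℂ) * I_sq
  · refine Finset.prod_congr rfl fun j _ => ?_
    push_cast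
    linear_combination (-ε : ℂ) * I_sq

theorem integrable_contourIntegrand {ℓ : ℕ} (hℓ : 1 ≤ ℓ) (r : ℝ) {σ : Fin (ℓ + 1) → ℝ} {ε : ℝ}
    (hε : ∀ j, -σ j < ε) :
    Integrable fun x : ℝ => contourIntegrand r σ ((x : ℂ) - I * (ε : ℂ)) := by
  simp only [contourIntegrand_shift]
  refine (integrable_inv_prod hℓ fun j => (by linarith [hε j] : 0 < ε + σ j)).bdd_mul
    (c := Real.exp (ε * (r ^ 2 / 2))) (Continuous.aestronglyMeasurable (by fun_prop)) ?_
  refine Eventually.of_forall fun x => le_of_eq ?_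
  rw [Complex.norm_exp, Complex.re_mul_ofReal]
  simp

theorem levelVolume_eq_contour_integral {ℓ : ℕ} (hℓ : 1 ≤ ℓ) {r : ℝ} (hr : r ≠ 0)
    {σ : Fin (ℓ + 1) → ℝ} {ε : ℝ} (hε : ∀ j, -σ j < ε) :
    (levelVolume σ (r ^ 2 / 2) : ℂ) = (2 * (Real.pi : ℂ)) ^ ((ℓ : ℤ) - 1) *
      ∫ x : ℝ, contourIntegrand r σ ((x : ℂ) - I * (ε : ℂ)) := by
  have hpi : (2 * (Real.pi : ℂ)) ≠ 0 := by simp [Real.pi_ne_zero]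
  have ht : 0 < r ^ 2 / 2 := by positivity
  have hb (j) : 0 < ε + σ j := by linarith [hε j]
  have h := laplace_inversion (f := fun τ => (levelVolume σ τ : ℂ)) (ε := ε)
    (F := fun x => (2 * (Real.pi : ℂ)) ^ ℓ * (∏ j, (((ε + σ j : ℝ) : ℂ) + x * I))⁻¹) ht
    (integrableOn_exp_mul_levelVolume (s := ε) (by simpa using hb))
    (continuous_ofReal.comp (continuous_levelVolume σ)).continuousAt
    (fun x => by
      rw [laplace_levelVolume (s := ε + x * I) (by simpa using hb), div_eq_mul_inv]
      congr 2
      refine Finset.prod_congr rfl fun j _ => ?_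
      push_cast
      ring)
    ((integrable_inv_prod hℓ hb).const_mul _)
  simp only [contourIntegrand_shift]
  simp only [mul_left_comm _ ((2 * (Real.pi : ℂ)) ^ ℓ)] at h
  rw [integral_const_mul] at h
  rw [zpow_sub_one₀ hpi, zpow_natCast, mul_right_comm, h, mul_comm (2 * (Real.pi : ℂ)),
    mul_inv_cancel_right₀ hpi]

/-- For `ℓ = 0` the reduced space is a point. -/
theorem levelVolume_zero (σ : Fin 1 → ℝ) (t : ℝ) :
    levelVolume (ℓ := 0) σ t = Real.exp (-(σ 0 * t)) := by
  simp [levelVolume, chartDensity, Measure.volume_pi_eq_dirac (fun _ => (0 : ℂ)), mul_comm]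

theorem tendsto_contour_integral {ℓ : ℕ} {r : ℝ} (hr : r ≠ 0) {σ : Fin (ℓ + 1) → ℝ} {ε : ℝ}
    (hε : ∀ j, -σ j < ε) :
    Tendsto (fun R : ℝ × ℝ => (2 * (Real.pi : ℂ)) ^ ((ℓ : ℤ) - 1) *
        ∫ x in (-R.1)..R.2, contourIntegrand r σ ((x : ℂ) - I * (ε : ℂ)))
      (atTop ×ˢ atTop) (𝓝 (levelVolume σ (r ^ 2 / 2) : ℂ)) := by
  rcases Nat.eq_zero_or_pos ℓ with rfl | hℓ
  · have hpi : (2 * (Real.pi : ℂ)) ≠ 0 := by simp [Real.pi_ne_zero]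
    have ht : 0 < r ^ 2 / 2 := by positivity
    have h := (tendsto_integral_exp_div ht
      (by linarith [hε 0] : 0 < ε + σ 0)).const_mul ((2 * (Real.pi : ℂ))⁻¹)
    rw [inv_mul_cancel_left₀ hpi] at h
    simp only [contourIntegrand_shift, levelVolume_zero]
    simpa using h
  · rw [levelVolume_eq_contour_integral hℓ hr hε]
    exact (intervalIntegral_tendsto_integral (integrable_contourIntegrand hℓ r hε)
      (tendsto_neg_atTop_atBot.comp tendsto_fst) tendsto_snd).const_mul _

end ProjectiveReduction

theorem mainTheorem6 (ℓ : ℕ) (r : ℝ) (hr : r ≠ 0) (σ : Fin (ℓ + 1) → ℝ) (ε : ℝ)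
    (hε : ∀ j, -σ j < ε) :
    (ProjectiveReduction.equivariantChernForm ℓ r σ).scale (r ^ 2 / 2) =
        ProjectiveReduction.equivariantSymplecticForm ℓ r σ ∧
      Tendsto
        (fun R : ℝ × ℝ => (2 * (Real.pi : ℂ)) ^ ((ℓ : ℤ) - 1) *
          ∫ x in (-R.1)..R.2, ProjectiveReduction.contourIntegrand r σ ((x : ℂ) - I * (ε : ℂ)))
        (atTop ×ˢ atTop)
        (𝓝 ((((ProjectiveReduction.equivariantChernForm ℓ r σ).scale
          (r ^ 2 / 2)).integralExp : ℝ) : ℂ)) ∧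
      (1 ≤ ℓ →
        Integrable
            (fun x : ℝ => ProjectiveReduction.contourIntegrand r σ ((x : ℂ) - I * (ε : ℂ))) ∧
          ((((ProjectiveReduction.equivariantChernForm ℓ r σ).scale
              (r ^ 2 / 2)).integralExp : ℝ) : ℂ) =
            (2 * (Real.pi : ℂ)) ^ ((ℓ : ℤ) - 1) *
              ∫ x : ℝ, ProjectiveReduction.contourIntegrand r σ ((x : ℂ) - I * (ε : ℂ))) := by
  have hvol : ((ProjectiveReduction.equivariantChernForm ℓ r σ).scale (r ^ 2 / 2)).integralExp =
      ProjectiveReduction.levelVolume σ (r ^ 2 / 2) := by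
    rw [ProjectiveReduction.scale_equivariantChernForm hr,
      ProjectiveReduction.integralExp_equivariantSymplecticForm hr, ProjectiveReduction.levelVolume]
  rw [hvol]
  exact ⟨ProjectiveReduction.scale_equivariantChernForm hr σ,
    ProjectiveReduction.tendsto_contour_integral hr hε,
    fun hℓ => ⟨ProjectiveReduction.integrable_contourIntegrand hℓ r hε,
      ProjectiveReduction.levelVolume_eq_contour_integral hℓ hr hε⟩⟩
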